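/- Let $K$ be an algebraically closed field of characteristic $0$, let $T=(K^\times)^r$ be a torus with Lie algebra $\mathfrak t=K^r$, and let $T$ act on $V=K^n$ with weights $s_1,\dots,s_n\in\mathbb Z^r$, that is, $t\cdot v=\big(\prod_j t_j^{s_i^j}\,v_i\big)_i$; every finite-dimensional rational representation of a torus is of this form in suitable coordinates. Let $T$ act on $V^*$ by the contragredient action and diagonally on $V\oplus V^*$, and let $\mu:V\oplus V^*\to\mathfrak t^*$, $\mu(x,\varphi)(h)=\varphi(h\cdot x)$, be the moment map. "Closed" refers to the Zariski topology. An element $x\in V$ is nilpotent if $0\in\overline{T.x}$, and $(T,V)$ is visible if it has finitely many nilpotent $T$-orbits. (1) The representation $(T,V)$ is visible if and only if the closed $T$-orbits in $\mu^{-1}(0)$ are exactly the orbits $T.(x,y)$ with $(x,y)\in\mu^{-1}(0)$ and with both $T.x\subset V$ and $T.y\subset V^*$ closed. (2) The visibility hypothesis is necessary in the following conjecture (Conjecture A, stated for $K=\mathbb C$ and all connected reductive groups): if $(G,V)$ is visible and polar, then $\mu^{-1}(0)/\!/G\cong(\mathfrak c\oplus\mathfrak c^\vee)/W$ as Poisson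 varieties, where $\mathfrak c$ is a Cartan subspace of $V$, $\mathfrak c^\vee$ is a dual Cartan subspace of $V^*$ (isomorphic to $\mathfrak c^*$ as a $W$-module) and $W=N_G(\mathfrak c)/C_G(\mathfrak c)$. Precisely, call $\mathfrak c\subset V$ a Cartan subspace if $\mathfrak c=\{x\in V\mid\mathfrak t\cdot x\subseteq\mathfrak t\cdot v\}$ for some $v\in V$ and $\dim\mathfrak c=\dim V/\!/T$; $(T,V)$ is polar if a Cartan subspace exists. Assume that $(T,V)$ is polar and not visible, let $\mathfrak c$ be any Cartan subspace of $V$ and let $W=N_T(\mathfrak c)/C_T(\mathfrak c)$. Then: (a) for every linear subspace $\mathfrak c'\subset V^*$ (in particular for $\mathfrak c'=\mathfrak c^\vee$), there is a closed $T$-orbit in $\mu^{-1}(0)$ that is not contained in the closure of the $T$-orbit of any point of $\mathfrak c\times\mathfrak c'$; in particular, the natural map $(\mathfrak c\oplus\mathfrak c^\vee)/W\to\mu^{-1}(0)/\!/T$ is not surjective; (b) the $K$-algebras $K[\mu^{-1}(0)]^T$ and $K[\mathfrak c\oplus\mathfrak c^*]^W$ are not isomorphic, where $\mu^{-1}(0)$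 is the scheme-theoretic fibre; so $\mu^{-1}(0)/\!/T$ and $(\mathfrak c\oplus\mathfrak c^*)/W$ are not isomorphic as varieties, hence not as Poisson varieties. -/

import Mathlib

noncomputable section

namespace MomentTorus

/-! ### Polynomial functions and the Zariski topology of a vector space -/

section Zariski

variable (K : Type*) [Field K] (W : Type*) [AddCommGroup W] [Module K W]

/-- The algebra `K[W]` of polynomial functions on a `K`-vector space `W`: the algebra of
functions generated by the linear forms. -/
def polyFun : Subalgebra K (W → K) :=
  Algebra.adjoin K (Set.range fun l : Module.Dual K W => (l : W → K))

variable {K W} {W' : Type*} [AddCommGroup W'] [Module K W']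

theorem polyFun_comp_mem (g : W' →ₗ[K] W) {f : W → K} (hf : f ∈ polyFun K W) :
    f ∘ g ∈ polyFun K W' := by
  unfold polyFun at hf
  induction hf using Algebra.adjoin_induction with
  | mem f hf =>
    obtain ⟨l, rfl⟩ := hf
    exact Algebra.subset_adjoin ⟨l.comp g, rfl⟩
  | algebraMap a => exact (polyFun K W').algebraMap_mem a
  | add f₁ f₂ _ _ h₁ h₂ => exact (polyFun K W').add_mem h₁ h₂
  | mul f₁ f₂ _ _ h₁ h₂ => exact (polyFun K W').mul_mem h₁ h₂

/-- Pull-back of polynomial functions along a linear map. -/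
def polyFunComap (g : W' →ₗ[K] W) : polyFun K W →ₐ[K] polyFun K W' where
  toFun f := ⟨f.1 ∘ g, polyFun_comp_mem g f.2⟩
  map_one' := rfl
  map_mul' _ _ := rfl
  map_zero' := rfl
  map_add' _ _ := rfl
  commutes' _ := rfl

variable (K) in
/-- `Z` is the common zero locus of a set of polynomial functions. -/
def IsZariskiClosed (Z : Set W) : Prop :=
  ∃ F : Set (polyFun K W), Z = {w | ∀ f ∈ F, f.1 w = 0}

variable (K) in
/-- The Zariski closure of `Z`. -/
def zariskiClosure (Z : Set W) : Set W :=
  {w | ∀ f : polyFun K W, (∀ z ∈ Z, f.1 z = 0) → f.1 w = 0}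

end Zariski

/-! ### Orbits, semisimple and nilpotent elements, visible representations, invariants -/

section Rep

variable {K : Type*} [Field K] {G : Type*} [Group G] {V : Type*} [AddCommGroup V] [Module K V]

/-- The orbit `G.x`. -/
def repOrbit (ρ : Representation K G V) (x : V) : Set V :=
  Set.range fun g : G => ρ g x

/-- `x` is semisimple: its orbit is closed. -/
def IsSemisimpleElt (ρ : Representation K G V) (x : V) : Prop :=
  IsZariskiClosed K (repOrbit ρ x)

/-- `x` is nilpotent: the closure of its orbit contains `0`. -/
def IsNilpotentElt (ρ : Representation K G V) (x : V) : Prop :=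
  (0 : V) ∈ zariskiClosure K (repOrbit ρ x)

/-- The representation is visible: there are finitely many nilpotent orbits. -/
def IsVisible (ρ : Representation K G V) : Prop :=
  {O : Set V | ∃ x, IsNilpotentElt ρ x ∧ O = repOrbit ρ x}.Finite

/-- The algebra `K[V]^G` of invariant polynomial functions, that is, the coordinate ring of the
categorical quotient `V // G`. -/
def invariantFun (ρ : Representation K G V) : Subalgebra K (polyFun K V) where
  carrier := {f | ∀ g : G, polyFunComap (ρ g) f = f}
  mul_mem' ha hb g := by rw [map_mul, ha g, hb g]
  add_mem' ha hb g := by rw [map_add, ha g, hb g]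
  algebraMap_mem' a g := AlgHom.commutes _ a

/-- The representation of `G` on `V ⊕ V*`, with the contragredient action on `V*`. -/
def doubleRep (ρ : Representation K G V) : Representation K G (V × Module.Dual K V) :=
  ρ.prod ρ.dual

end Rep

/-! ### Moment map, symplectic reduction, Cartan subspaces

Here `𝔤` is the Lie algebra of `G` (only its underlying vector space is needed), acting on `V`
through the differential `dρ` of the representation `ρ`. -/

section Moment

variable {K : Type*} [Field K] {G : Type*} [Group G] {V : Type*} [AddCommGroup V] [Module K V]
  {𝔤 : Type*} [AddCommGroup 𝔤] [Module K 𝔤]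

/-- The moment map `V ⊕ V* → 𝔤*`, `(x, φ) ↦ (h ↦ φ (h · x))`. -/
def momentMap (dρ : 𝔤 →ₗ[K] Module.End K V) (z : V × Module.Dual K V) : Module.Dual K 𝔤 :=
  z.2 ∘ₗ dρ.flip z.1

/-- The points of the null fibre of the moment map. -/
def nullFibre (dρ : 𝔤 →ₗ[K] Module.End K V) : Set (V × Module.Dual K V) :=
  {z | momentMap dρ z = 0}

/-- The ideal of the scheme `μ⁻¹(0)`: it is generated by the components of the moment map, that
is, by the functions `z ↦ μ(z)(h)` for `h` in the Lie algebra. -/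
def momentIdeal (dρ : 𝔤 →ₗ[K] Module.End K V) : Ideal (polyFun K (V × Module.Dual K V)) :=
  Ideal.span {f | ∃ h : 𝔤, ∀ z, f.1 z = momentMap dρ z h}

/-- Polynomial functions on `V ⊕ V*` whose class modulo the ideal of `μ⁻¹(0)` is invariant. -/
def invariantModMoment (ρ : Representation K G V) (dρ : 𝔤 →ₗ[K] Module.End K V) :
    Subalgebra K (polyFun K (V × Module.Dual K V)) where
  carrier := {f | ∀ g : G, polyFunComap (doubleRep ρ g) f - f ∈ momentIdeal dρ}
  mul_mem' := by
    intro a b ha hb g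
    have h := (momentIdeal dρ).add_mem
      ((momentIdeal dρ).mul_mem_left (polyFunComap (doubleRep ρ g) a) (hb g))
      ((momentIdeal dρ).mul_mem_left b (ha g))
    rw [map_mul]
    convert h using 1
    ring
  add_mem' := by
    intro a b ha hb g
    have h := (momentIdeal dρ).add_mem (ha g) (hb g)
    rw [map_add]
    convert h using 1
    ring
  algebraMap_mem' := by
    intro a g
    rw [AlgHom.commutes, sub_self]
    exact (momentIdeal dρ).zero_mem

/-- The algebra `K[μ⁻¹(0)]^G`, that is, the coordinate ring of the symplectic reduction
`(V ⊕ V*) /// G = μ⁻¹(0) // G`. -/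
def symplecticReductionRing (ρ : Representation K G V) (dρ : 𝔤 →ₗ[K] Module.End K V) :
    Subalgebra K (polyFun K (V × Module.Dual K V) ⧸ momentIdeal dρ) :=
  (invariantModMoment ρ dρ).map (Ideal.Quotient.mkₐ K (momentIdeal dρ))

/-- The tangent space `𝔤 · x`. -/
def tangentSpace (dρ : 𝔤 →ₗ[K] Module.End K V) (x : V) : Submodule K V :=
  LinearMap.range (dρ.flip x)

/-- The subspace `{x | 𝔤 · x ⊆ 𝔤 · v}`. -/
def cartanOf (dρ : 𝔤 →ₗ[K] Module.End K V) (v : V) : Submodule K V where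
  carrier := {x | tangentSpace dρ x ≤ tangentSpace dρ v}
  zero_mem' := by
    rintro _ ⟨h, rfl⟩
    simp
  add_mem' := by
    rintro a b ha hb _ ⟨h, rfl⟩
    rw [map_add, LinearMap.add_apply]
    exact add_mem (ha ⟨h, rfl⟩) (hb ⟨h, rfl⟩)
  smul_mem' := by
    rintro k a ha _ ⟨h, rfl⟩
    rw [map_smul, LinearMap.smul_apply]
    exact Submodule.smul_mem _ k (ha ⟨h, rfl⟩)

/-- `c` is a Cartan subspace of `V`: `c = {x | 𝔤 · x ⊆ 𝔤 · v}` for some `v`, and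
`dim c = dim V // G`. The dimension of the irreducible variety `V // G` is the transcendence
degree of its coordinate ring. -/
def IsCartanSubspace (ρ : Representation K G V) (dρ : 𝔤 →ₗ[K] Module.End K V)
    (c : Submodule K V) : Prop :=
  ∃ v : V, c = cartanOf dρ v ∧ (Module.finrank K c : Cardinal) = Algebra.trdeg K (invariantFun ρ)

/-- The Weyl group `N_G(c) / C_G(c)` of a subspace `c`, as the group of the automorphisms of `c`
that are induced by an element of `G`. -/
def weylGroup (ρ : Representation K G V) (c : Submodule K V) : Subgroup (c ≃ₗ[K] c) where
  carrier := {w | ∃ g : G, ∀ x : c, ρ g x = w x}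
  one_mem' := ⟨1, fun x => by simp⟩
  mul_mem' := by
    rintro a b ⟨g, hg⟩ ⟨h, hh⟩
    exact ⟨g * h, fun x => by simp [hh, hg]⟩
  inv_mem' := by
    rintro a ⟨g, hg⟩
    refine ⟨g⁻¹, fun x => ?_⟩
    have h := hg (a⁻¹ x)
    rw [show a (a⁻¹ x) = x from a.apply_symm_apply x] at h
    rw [← h, ← Module.End.mul_apply, ← map_mul]
    simp

/-- The diagonal action of an automorphism `w` of `c` on `c ⊕ c*`:
`(x, φ) ↦ (w x, φ ∘ w⁻¹)`. -/
def doubleAut {c : Submodule K V} (w : c ≃ₗ[K] c) :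
    (c × Module.Dual K c) →ₗ[K] (c × Module.Dual K c) :=
  w.toLinearMap.prodMap (w.symm.toLinearMap.dualMap)

/-- The algebra `K[c ⊕ c*]^W`, that is, the coordinate ring of `(c ⊕ c*) / W`, for `W` the Weyl
group of `c`. -/
def weylInvariantRing (ρ : Representation K G V) (c : Submodule K V) :
    Subalgebra K (polyFun K (c × Module.Dual K c)) where
  carrier := {f | ∀ w ∈ weylGroup ρ c, polyFunComap (doubleAut w) f = f}
  mul_mem' ha hb w hw := by rw [map_mul, ha w hw, hb w hw]
  add_mem' ha hb w hw := by rw [map_add, ha w hw, hb w hw]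
  algebraMap_mem' a w _ := AlgHom.commutes _ a

end Moment

/-! ### Representations of tori -/

section Torus

variable (K : Type*) [Field K] {r n : ℕ}

/-- The representation of the torus `(Kˣ)^r` on `K^n` with weights `s 0, …, s (n - 1)`:
`t` multiplies the coordinate `i` by `∏ j, t j ^ s i j`. -/
def torusRep (s : Fin n → Fin r → ℤ) : Representation K (Fin r → Kˣ) (Fin n → K) where
  toFun t := LinearMap.pi fun i =>
    ((∏ j, t j ^ s i j : Kˣ) : K) • (LinearMap.proj i : (Fin n → K) →ₗ[K] K)
  map_one' := by
    ext
    simp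
  map_mul' t u := by
    refine LinearMap.ext fun v => funext fun i => ?_
    simp [mul_zpow, Finset.prod_mul_distrib, mul_assoc]

/-- The differential of `torusRep K s`: `h` in the Lie algebra `K^r` multiplies the coordinate `i`
by `∑ j, s i j * h j`. -/
def torusLie (s : Fin n → Fin r → ℤ) : (Fin r → K) →ₗ[K] Module.End K (Fin n → K) :=
  LinearMap.mk₂ K (fun h v i => (∑ j, (s i j : K) * h j) * v i)
    (fun h h' v => by
      funext i
      simp [mul_add, Finset.sum_add_distrib, add_mul])
    (fun a h v => by
      funext i
      simp only [Pi.smul_apply, smul_eq_mul]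
      rw [← mul_assoc, Finset.mul_sum]
      congr 1
      exact Finset.sum_congr rfl fun j _ => by ring)
    (fun h v v' => by
      funext i
      simp [mul_add])
    (fun a h v => by
      funext i
      simp only [Pi.smul_apply, smul_eq_mul]
      ring)

end Torus

end MomentTorus

end

/-!
Everything is governed by the linear relations among the weights. An orbit `T.x` is closed iff the
weights on the support of `x` satisfy a strictly positive relation; `(T, V)` is visible iff the
support of every nonzero relation contains that of a nonzero nonnegative relation; and `(x, y)` lies
in `μ⁻¹(0)` iff the pointwise product of `x` and `y` is a relation with coefficients in `K`.

In the non-visible polar case let `𝔠 = {x | 𝔱 · x ⊆ 𝔱 · v}` and let `ω` be a relation of maximal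
support among those supported on the support of `v`. The map `x ↦ ω x / v` sends `𝔠` to the
`m`-dimensional space of all relations. If it were onto, relations would be stable under
multiplication by `x / v`, so that `c² / a` would be a relation for every integral relation `c`,
where `a` is a nonnegative relation of maximal support; this is the visibility criterion. Hence its
rank is less than `m`. The closed orbits through the points `(p, u / p)`, where `u` is a relation of
maximal support and `p` has the same support, cannot all be reached from `𝔠 × 𝔠'`: on them the
invariants `x ^ c` of `m` independent integral relations `c` take all nonzero values, while on `𝔠`
they depend only on `ω x / v`. Similarly the transcendence degree of `K[μ⁻¹(0)]ᵀ` is at least `2m`,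
whereas that of `K[𝔠 ⊕ 𝔠*]ᵂ` is at most `(m - 1) + m`.
-/

noncomputable section

namespace MomentTorus

universe u

section Farkas

variable {F V ι : Type*} [Field F] [LinearOrder F] [IsStrictOrderedRing F] [AddCommGroup V]
  [Module F V]

open PointedCone in
theorem farkas (a : ι → Module.Dual F V) (I : Finset ι) (b : Module.Dual F V)
    (h : ∀ x, (∀ i ∈ I, 0 ≤ a i x) → 0 ≤ b x) : b ∈ hull F (a '' I) := by
  classical
  induction I using Finset.induction_on generalizing a b with
  | empty =>
    have hb : b = 0 := LinearMap.ext fun x =>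
      le_antisymm (by simpa using h (-x) (by simp)) (h x (by simp))
    simp [hb]
  | insert k I _ ih =>
    by_cases hb : ∀ x, (∀ i ∈ I, 0 ≤ a i x) → 0 ≤ b x
    · exact Submodule.span_mono (Set.image_mono (by simp)) (ih a b hb)
    push Not at hb
    obtain ⟨y, hy, hby⟩ := hb
    have hky : 0 < -a k y := by
      by_contra! hky
      exact hby.not_ge (h y (by simpa using ⟨by simpa using hky, hy⟩))
    obtain ⟨z, hz, hkz, hbz⟩ : ∃ z, (∀ i ∈ I, 0 ≤ a i z) ∧ a k z = -1 ∧ b z < 0 := by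
      refine ⟨(-a k y)⁻¹ • y, fun i hi => ?_, ?_, ?_⟩
      · simpa using mul_nonneg (inv_nonneg.2 hky.le) (hy i hi)
      · rw [map_smul, smul_eq_mul, inv_neg, neg_mul, inv_mul_cancel₀ (neg_pos.1 hky).ne]
      · simpa using mul_neg_of_pos_of_neg (inv_pos.2 hky) hby
    -- The shear `P` moves every form by a multiple of `a k` and kills its value at `z`.
    let P : Module.Dual F V →ₗ[F] Module.Dual F V :=
      LinearMap.id + (Module.Dual.eval F V z).smulRight (a k)
    have hP (f : Module.Dual F V) : P f = f + f z • a k := rfl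
    have hmem : P b ∈ (hull F (a '' I)).map P := by
      rw [PointedCone.map, Submodule.map_span, ← Set.image_comp]
      refine ih _ _ fun x hx => ?_
      have hx' := h (x + a k x • z) (by simpa [hkz, hP, mul_comm] using hx)
      simpa [hP, mul_comm] using hx'
    obtain ⟨c, hc, hcb⟩ := hmem
    have hcz : 0 ≤ c z := by
      have hle : hull F (a '' I) ≤ dual (Module.Dual.eval F V) {z} :=
        Submodule.span_le.2 (by rintro _ ⟨i, hi, rfl⟩ _ rfl; exact hz i hi)
      exact hle hc rfl
    have hbc : b = c + (c z - b z) • a k := by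
      ext x
      have hx : c x + c z * a k x = b x + b z * a k x := LinearMap.congr_fun hcb x
      simp only [LinearMap.add_apply, LinearMap.smul_apply, smul_eq_mul]
      linear_combination -hx
    rw [hbc]
    exact add_mem (Submodule.span_mono (Set.image_mono (by simp)) hc)
      (PointedCone.smul_mem _ (by linarith) (Submodule.subset_span ⟨k, by simp, rfl⟩))

end Farkas

section Relations

open Function

variable {ι κ : Type*} [Fintype ι]

/-- The `R`-linear relations among the integer vectors `w i`. -/
def relations (R : Type*) [CommRing R] (w : ι → κ → ℤ) : Submodule R (ι → R) :=
  LinearMap.ker (Fintype.linearCombination R fun i j => (w i j : R))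

variable {R S : Type*} [CommRing R] [CommRing S] {w : ι → κ → ℤ}

theorem mem_relations {u : ι → R} : u ∈ relations R w ↔ ∀ j, ∑ i, u i * (w i j : R) = 0 := by
  simp [relations, Fintype.linearCombination_apply, funext_iff]

theorem map_mem_relations (φ : R →+ S) {u : ι → R} (hu : u ∈ relations R w) :
    (fun i => φ (u i)) ∈ relations S w := by
  refine mem_relations.2 fun j => ?_
  have h := congrArg φ (mem_relations.1 hu j)
  have hφ (i : ι) : φ (u i * (w i j : R)) = φ (u i) * (w i j : S) := by
    rw [mul_comm, ← zsmul_eq_mul, map_zsmul, zsmul_eq_mul, mul_comm]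
  simpa only [hφ, map_sum, map_zero] using h

theorem intCast_mem_relations_iff [CharZero R] {c : ι → ℤ} :
    (fun i => (c i : R)) ∈ relations R w ↔ c ∈ relations ℤ w := by
  refine ⟨fun h => mem_relations.2 fun j => ?_, map_mem_relations (Int.castAddHom R)⟩
  have h := mem_relations.1 h j
  exact_mod_cast h

theorem sum_mul_dotProduct_eq_zero [Fintype κ] {u : ι → R} (hu : u ∈ relations R w) (h : κ → R) :
    ∑ i, u i * ((fun j => (w i j : R)) ⬝ᵥ h) = 0 := by
  have hu : ∑ i, u i • (fun j => (w i j : R)) = 0 := hu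
  simpa [sum_dotProduct, smul_dotProduct] using congrArg (· ⬝ᵥ h) hu

theorem exists_pos_int_mul {ι : Type*} [Finite ι] (f : ι → ℚ) :
    ∃ N : ℤ, 0 < N ∧ ∃ g : ι → ℤ, ∀ i, (g i : ℚ) = N * f i := by
  obtain ⟨b, hb⟩ := IsLocalization.exist_integer_multiples_of_finite (nonZeroDivisors ℤ) f
  choose g hg using hb
  refine ⟨b * b, mul_self_pos.2 (nonZeroDivisors.coe_ne_zero b), fun i => b * g i, fun i => ?_⟩
  have hgi : (g i : ℚ) = b * f i := by simpa using hg i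
  push_cast
  rw [hgi, mul_assoc]

theorem exists_pos_int_mul_mem_relations {u : ι → ℚ} (hu : u ∈ relations ℚ w) :
    ∃ N : ℤ, 0 < N ∧ ∃ c ∈ relations ℤ w, ∀ i, (c i : ℚ) = N * u i := by
  obtain ⟨N, hN, c, hc⟩ := exists_pos_int_mul u
  refine ⟨N, hN, c, (intCast_mem_relations_iff (R := ℚ)).1 ?_, hc⟩
  rw [funext hc]
  exact Submodule.smul_mem _ (N : ℚ) hu

theorem exists_nonneg_int_relation_support_eq {u : ι → ℚ} (hu : u ∈ relations ℚ w)
    (hu0 : 0 ≤ u) :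
    ∃ a ∈ relations ℤ w, 0 ≤ a ∧ support a = support u := by
  obtain ⟨N, hN, a, ha, hau⟩ := exists_pos_int_mul_mem_relations hu
  replace hN : (0 : ℚ) < N := mod_cast hN
  refine ⟨a, ha, fun i => ?_, Set.ext fun i => ?_⟩
  · exact_mod_cast (hau i).symm ▸ mul_nonneg hN.le (hu0 i)
  · rw [mem_support, mem_support, ← Int.cast_ne_zero (α := ℚ), hau i, mul_ne_zero_iff]
    exact and_iff_right hN.ne'

section Field

variable {K : Type*} [Field K] [CharZero K]

theorem exists_intCast_eq_mul_of_dual {u : ι → K} (hu : u ∈ relations K w)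
    (φ : Module.Dual ℚ K) :
    ∃ N : ℤ, 0 < N ∧ ∃ c ∈ relations ℤ w, support c ⊆ support u ∧ ∀ i, (c i : ℚ) = N * φ (u i) := by
  obtain ⟨N, hN, c, hc, hcu⟩ :=
    exists_pos_int_mul_mem_relations (map_mem_relations φ.toAddMonoidHom hu)
  refine ⟨N, hN, c, hc, fun i hi hui => hi ?_, hcu⟩
  have hci := hcu i
  simpa [hui] using hci

theorem exists_int_relation_of_ne_zero {u : ι → K} (hu : u ∈ relations K w) {i : ι}
    (hi : u i ≠ 0) : ∃ c ∈ relations ℤ w, support c ⊆ support u ∧ c i ≠ 0 := by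
  obtain ⟨φ, hφ⟩ : ∃ φ : Module.Dual ℚ K, φ (u i) ≠ 0 := by
    by_contra! h
    exact hi ((Module.forall_dual_apply_eq_zero_iff ℚ _).1 h)
  obtain ⟨N, hN, c, hc, hcu, hcφ⟩ := exists_intCast_eq_mul_of_dual hu φ
  refine ⟨c, hc, hcu, fun hci => ?_⟩
  have h := hcφ i
  simp [hci, hφ, hN.ne'] at h

theorem mem_spanSubset_iff_support_subset {ι : Type*} [Finite ι] {S : Set ι} {u : ι → R} :
    u ∈ Pi.spanSubset R S ↔ support u ⊆ S := by
  rw [Pi.mem_spanSubset_iff, support_subset_iff']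

/-- The relations supported in `S`. -/
def relationsOn (R : Type*) [CommRing R] (w : ι → κ → ℤ) (S : Set ι) : Submodule R (ι → R) :=
  relations R w ⊓ Pi.spanSubset R S

theorem mem_relationsOn {S : Set ι} {u : ι → R} :
    u ∈ relationsOn R w S ↔ u ∈ relations R w ∧ support u ⊆ S := by
  rw [relationsOn, Submodule.mem_inf, mem_spanSubset_iff_support_subset]

theorem intCast_mem_relationsOn {S : Set ι} {c : ι → ℤ} (hc : c ∈ relationsOn ℤ w S) :
    (fun i => (c i : R)) ∈ relationsOn R w S := by
  obtain ⟨hc, hcS⟩ := mem_relationsOn.1 hc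
  refine mem_relationsOn.2 ⟨map_mem_relations (Int.castAddHom R) hc, fun i hi => hcS fun h => hi ?_⟩
  exact (congrArg Int.cast h).trans Int.cast_zero

theorem relationsOn_univ : relationsOn R w Set.univ = relations R w := by
  ext u
  simp [mem_relationsOn]

theorem relationsOn_eq_span_intCast (w : ι → κ → ℤ) (S : Set ι) :
    relationsOn K w S =
      Submodule.span K ((fun c i => (c i : K)) '' (relationsOn ℤ w S : Set (ι → ℤ))) := by
  classical
  refine le_antisymm (fun u hu => ?_) (Submodule.span_le.2 ?_)
  · obtain ⟨hu, huS⟩ := mem_relationsOn.1 hu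
    let b := Module.Basis.ofVectorSpace ℚ K
    have hsum : u = ∑ β ∈ Finset.univ.biUnion fun i => (b.repr (u i)).support,
        b β • fun i => ((b.coord β (u i) : ℚ) : K) := by
      funext i
      conv_lhs => rw [← b.linearCombination_repr (u i), Finsupp.linearCombination_apply,
        Finsupp.sum_of_support_subset _ (Finset.subset_biUnion_of_mem
          (fun i => (b.repr (u i)).support) (Finset.mem_univ i)) _ (by simp)]
      simp [Algebra.smul_def, mul_comm]
    rw [hsum]
    refine Submodule.sum_mem _ fun β _ => Submodule.smul_mem _ _ ?_
    obtain ⟨N, hN, c, hc, hcu, hcβ⟩ := exists_intCast_eq_mul_of_dual hu (b.coord β)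
    have hcK : (fun i => ((b.coord β (u i) : ℚ) : K)) = (N : K)⁻¹ • fun i => (c i : K) := by
      funext i
      have h : (c i : K) = N * ((b.coord β (u i) : ℚ) : K) := by exact_mod_cast hcβ i
      simp [h, hN.ne']
    rw [hcK]
    exact Submodule.smul_mem _ _
      (Submodule.subset_span ⟨c, mem_relationsOn.2 ⟨hc, hcu.trans huS⟩, rfl⟩)
  · rintro _ ⟨c, hc, rfl⟩
    exact intCast_mem_relationsOn hc

theorem exists_int_basis_relationsOn (w : ι → κ → ℤ) (S : Set ι) :
    ∃ c : Fin (Module.finrank K (relationsOn K w S)) → ι → ℤ,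
      (∀ k, c k ∈ relationsOn ℤ w S) ∧ LinearIndependent ℤ c := by
  rw [relationsOn_eq_span_intCast]
  obtain ⟨f, hf, -, hind⟩ := Submodule.exists_fun_fin_finrank_span_eq K
    ((fun (c : ι → ℤ) i => (c i : K)) '' (relationsOn ℤ w S : Set (ι → ℤ)))
  choose c hc hcf using hf
  rw [← funext hcf] at hind
  exact ⟨c, hc, LinearIndependent.of_comp ((Algebra.linearMap ℤ K).compLeft ι)
    (hind.restrict_scalars' ℤ)⟩

end Field

end Relations

section Positivity

open Function

variable {ι κ : Type*} [Fintype ι] [Fintype κ]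

theorem exists_nonneg_relation_or_dotProduct_pos (w : ι → κ → ℤ) {S : Set ι} {k : ι}
    (hk : k ∈ S) :
    (∃ a ∈ relations ℤ w, 0 ≤ a ∧ support a ⊆ S ∧ 0 < a k) ∨
      ∃ l : κ → ℤ, (∀ i ∈ S, 0 ≤ l ⬝ᵥ w i) ∧ 0 < l ⬝ᵥ w k := by
  classical
  lift S to Finset ι using S.toFinite
  let A (i : ι) : Module.Dual ℚ (κ → ℚ) := dotProductEquiv ℚ κ fun j => (w i j : ℚ)
  have hA (i : ι) (x : κ → ℚ) : A i x = (fun j => (w i j : ℚ)) ⬝ᵥ x := rfl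
  by_cases h : ∀ x, (∀ i ∈ S, 0 ≤ A i x) → 0 ≤ (-A k) x
  · left
    obtain ⟨c, hc⟩ := (Submodule.mem_span_image_finset_iff_exists_fun' _).1 (farkas A S (-A k) h)
    set u : ι → ℚ := (S : Set ι).indicator (fun i => (c i : ℚ)) + Pi.single k 1
    have hu : u ∈ relations ℚ w := by
      refine mem_relations.2 fun j => ?_
      have hj : ∑ i ∈ S, (c i : ℚ) * w i j = -w k j := by
        simpa [LinearMap.sum_apply, hA, NNRat.smul_def, ← Nonneg.coe_smul] using
          LinearMap.congr_fun hc (Pi.single j 1)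
      simp [u, add_mul, Finset.sum_add_distrib, Set.indicator_apply, Pi.single_apply, hj]
    have hc0 : 0 ≤ (S : Set ι).indicator fun i => (c i : ℚ) :=
      Set.indicator_nonneg fun i _ => (c i).2
    have hu0 : 0 ≤ u := add_nonneg hc0 (Pi.single_nonneg.2 zero_le_one)
    have huk : 0 < u k := add_pos_of_nonneg_of_pos (hc0 k) (by simp)
    have huS : support u ⊆ S := support_subset_iff'.2 fun i hi => by
      simp_all [u, (ne_of_mem_of_not_mem hk hi).symm]
    obtain ⟨a, ha, ha0, hau⟩ := exists_nonneg_int_relation_support_eq hu hu0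
    have hak : k ∈ support a := hau ▸ huk.ne'
    exact ⟨a, ha, ha0, hau ▸ huS, (ha0 k).lt_of_ne' hak⟩
  · right
    push Not at h
    obtain ⟨x, hx, hkx⟩ := h
    obtain ⟨N, hN, l, hl⟩ := exists_pos_int_mul x
    have hlw (i : ι) : ((l ⬝ᵥ w i : ℤ) : ℚ) = N * A i x := by
      simp only [hA, dotProduct, Finset.mul_sum, Int.cast_sum, Int.cast_mul, hl]
      exact Finset.sum_congr rfl fun j _ => by ring
    have hN : (0 : ℚ) < N := mod_cast hN
    refine ⟨l, fun i hi => ?_, ?_⟩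
    · exact_mod_cast (hlw i).symm ▸ mul_nonneg hN.le (hx i hi)
    · exact_mod_cast (hlw k).symm ▸ mul_pos hN (by simpa using hkx)

/-- Tucker's strict complementarity. -/
theorem exists_nonneg_relation_dotProduct_complementary (w : ι → κ → ℤ) (S : Set ι) :
    ∃ a ∈ relations ℤ w, ∃ l : κ → ℤ, 0 ≤ a ∧ support a ⊆ S ∧
      (∀ i ∈ support a, l ⬝ᵥ w i = 0) ∧ ∀ i ∈ S \ support a, 0 < l ⬝ᵥ w i := by
  classical
  have hpair (k : S) : ∃ (a : ι → ℤ) (l : κ → ℤ), a ∈ relations ℤ w ∧ 0 ≤ a ∧ support a ⊆ S ∧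
      (∀ i ∈ S, 0 ≤ l ⬝ᵥ w i) ∧ 0 < a k + l ⬝ᵥ w k := by
    rcases exists_nonneg_relation_or_dotProduct_pos w k.2 with ⟨a, ha, ha0, haS, hak⟩ | ⟨l, hl, hlk⟩
    · exact ⟨a, 0, ha, ha0, haS, by simp, by simpa using hak⟩
    · exact ⟨0, l, zero_mem _, le_rfl, by simp, hl, by simpa using hlk⟩
  choose a l ha ha0 haS hl hal using hpair
  have hrel : ∑ k, a k ∈ relations ℤ w := sum_mem fun k _ => ha k
  have hnonneg : 0 ≤ ∑ k, a k := Finset.sum_nonneg fun k _ => ha0 k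
  have hsupp : support (∑ k, a k) ⊆ S := by
    refine support_subset_iff'.2 fun i hi => ?_
    rw [Finset.sum_apply]
    exact Finset.sum_eq_zero fun k _ => support_subset_iff'.1 (haS k) i hi
  have hform (i : ι) (hi : i ∈ S) : 0 ≤ (∑ k, l k) ⬝ᵥ w i := by
    rw [sum_dotProduct]
    exact Finset.sum_nonneg fun k _ => hl k i hi
  have hpos (i : ι) (hi : i ∈ S) : 0 < (∑ k, a k) i + (∑ k, l k) ⬝ᵥ w i := by
    rw [sum_dotProduct, Finset.sum_apply, ← Finset.sum_add_distrib]
    exact Finset.sum_pos' (fun k _ => add_nonneg (ha0 k i) (hl k i hi))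
      ⟨⟨i, hi⟩, Finset.mem_univ _, hal ⟨i, hi⟩⟩
  refine ⟨∑ k, a k, hrel, ∑ k, l k, hnonneg, hsupp, fun i hi => ?_, fun i ⟨hiS, hi⟩ => ?_⟩
  · have hsum := sum_mul_dotProduct_eq_zero hrel (∑ k, l k)
    simp only [Int.cast_id, dotProduct_comm (w _)] at hsum
    rw [Finset.sum_eq_zero_iff_of_nonneg fun i _ => ?_] at hsum
    · exact (mul_eq_zero.1 (hsum i (Finset.mem_univ i))).resolve_left hi
    · by_cases hiS : i ∈ S
      · exact mul_nonneg (hnonneg i) (hform i hiS)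
      · simp [support_subset_iff'.1 hsupp i hiS]
  · simpa [notMem_support.1 hi] using hpos i hiS

end Positivity

section PositivelyDependent

open Function

variable {ι κ : Type*} [Fintype ι]

theorem exists_nonneg_relation_support_eq {w : ι → κ → ℤ} {S : Set ι}
    (h : ∀ i ∈ S, ∃ d ∈ relations ℤ w, 0 ≤ d ∧ support d ⊆ S ∧ 0 < d i) :
    ∃ d ∈ relations ℤ w, 0 ≤ d ∧ support d = S := by
  classical
  choose! d hd hd0 hdS hdi using h
  refine ⟨∑ i ∈ S.toFinset, d i, sum_mem fun i hi => hd i (by simpa using hi),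
    Finset.sum_nonneg fun i hi => hd0 i (by simpa using hi), Set.Subset.antisymm ?_ fun j hj => ?_⟩
  · refine support_subset_iff'.2 fun j hj => ?_
    rw [Finset.sum_apply]
    exact Finset.sum_eq_zero fun i hi => support_subset_iff'.1 (hdS i (by simpa using hi)) j hj
  · rw [mem_support, Finset.sum_apply]
    exact (Finset.sum_pos' (fun i hi => hd0 i (by simpa using hi) j)
      ⟨j, by simpa using hj, hdi j hj⟩).ne'

/-- The vectors `w i` are positively dependent if the support of every nonzero relation among them
contains the support of a nonzero nonnegative relation. -/
def PositivelyDependent (w : ι → κ → ℤ) : Prop :=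
  ∀ c ∈ relations ℤ w, c ≠ 0 → ∃ e ∈ relations ℤ w, e ≠ 0 ∧ 0 ≤ e ∧ support e ⊆ support c

theorem support_smul_sub_smul_ssubset {ι : Type*} {c e : ι → ℤ} (hec : support e ⊆ support c)
    {m : ι} (hm : c m ≠ 0) : support (e m • c - c m • e) ⊂ support c := by
  refine (Set.ssubset_iff_of_subset fun i hi => ?_).2 ⟨m, hm, by simp [mul_comm]⟩
  by_contra hci
  simp [notMem_support.1 hci, notMem_support.1 (mt (@hec i) hci)] at hi

theorem exists_min_ratio {ι : Type*} [Finite ι] (f e : ι → ℤ) {S : Set ι} (hS : S.Nonempty)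
    (he : ∀ i ∈ S, 0 < e i) : ∃ k ∈ S, ∀ i ∈ S, f k * e i ≤ f i * e k := by
  obtain ⟨k, hk, hmin⟩ := S.exists_min_image (fun i => (f i : ℚ) / e i) S.toFinite hS
  refine ⟨k, hk, fun i hi => ?_⟩
  have h := hmin i hi
  rw [div_le_div_iff₀ (mod_cast he k hk) (mod_cast he i hi)] at h
  exact_mod_cast h

namespace PositivelyDependent

variable {w : ι → κ → ℤ} {c : ι → ℤ} {i : ι}

theorem exists_nonneg_of_ne_zero (hw : PositivelyDependent w) (hc : c ∈ relations ℤ w)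
    (hi : c i ≠ 0) : ∃ d ∈ relations ℤ w, 0 ≤ d ∧ support d ⊆ support c ∧ 0 < d i := by
  obtain ⟨c', ⟨hc', hcc', hi'⟩, hmin⟩ := exists_minimalFor_of_wellFoundedLT
    (fun c' => c' ∈ relations ℤ w ∧ support c' ⊆ support c ∧ c' i ≠ 0) support ⟨c, hc, le_rfl, hi⟩
  obtain ⟨e, he, he_ne, he0, hec'⟩ := hw c' hc' fun h => hi' (by simp [h])
  refine ⟨e, he, he0, hec'.trans hcc', (he0 i).lt_of_ne' fun hei => ?_⟩
  obtain ⟨m, hm⟩ := ne_iff.1 he_ne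
  have hlt := support_smul_sub_smul_ssubset hec' (hec' hm)
  refine hlt.2 (hmin ⟨sub_mem (Submodule.smul_mem _ _ hc') (Submodule.smul_mem _ _ he),
    hlt.1.trans hcc', ?_⟩ hlt.1)
  simpa [hei, hi'] using hm

theorem exists_nonneg_of_pos (hw : PositivelyDependent w) (hc : c ∈ relations ℤ w)
    (hi : 0 < c i) : ∃ d ∈ relations ℤ w, 0 ≤ d ∧ support d ⊆ {j | 0 < c j} ∧ 0 < d i := by
  obtain ⟨c', ⟨hc', hcc', hi'⟩, hmin⟩ := exists_minimalFor_of_wellFoundedLT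
    (fun c' => c' ∈ relations ℤ w ∧ {j | 0 < c' j} ⊆ {j | 0 < c j} ∧ 0 < c' i) support
    ⟨c, hc, le_rfl, hi⟩
  suffices h : 0 ≤ c' from
    ⟨c', hc', h, fun j hj => hcc' ((h j).lt_of_ne' hj), hi'⟩
  by_contra hneg
  obtain ⟨k, hk⟩ : ∃ k, c' k < 0 := by simpa [Pi.le_def] using hneg
  obtain ⟨e, he, he0, hec', hek⟩ := hw.exists_nonneg_of_ne_zero hc' hk.ne
  -- Adding the right multiple of `e` kills one negative coefficient and creates no positive one.
  obtain ⟨m, ⟨hm, hem⟩, hratio⟩ := exists_min_ratio (-c') e (S := {j | c' j < 0 ∧ 0 < e j})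
    ⟨k, hk, hek⟩ fun j hj => hj.2
  have hlt := support_smul_sub_smul_ssubset hec' hm.ne
  refine hlt.2 (hmin ⟨sub_mem (Submodule.smul_mem _ _ hc') (Submodule.smul_mem _ _ he),
    fun j hj => hcc' ?_, ?_⟩ hlt.1)
  · change 0 < e m * c' j - c' m * e j at hj
    by_contra hcj
    have hcj : c' j ≤ 0 := not_lt.1 hcj
    have hej : 0 ≤ e j := he0 j
    rcases hej.eq_or_lt' with hej | hej
    · rw [hej, mul_zero, sub_zero] at hj
      exact hj.not_ge (mul_nonpos_of_nonneg_of_nonpos hem.le hcj)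
    · have := hratio j ⟨hcj.lt_of_ne (hec' hej.ne'), hej⟩
      simp only [Pi.neg_apply] at this
      linarith [mul_comm (c' j) (e m)]
  · change 0 < e m * c' i - c' m * e i
    nlinarith [he0 i, mul_pos hem hi', mul_nonneg (neg_nonneg.2 hm.le) (he0 i)]

theorem exists_nonneg_support_eq {K : Type*} [Field K] [CharZero K] (hw : PositivelyDependent w)
    {a b : ι → ℤ} (hb : 0 ≤ b) (ha : 0 ≤ a) (hab : a - b ∈ relations ℤ w) {u : ι → K}
    (hu : u ∈ relations K w) (hsupp : support u = support a ∩ support b) :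
    ∃ d ∈ relations ℤ w, 0 ≤ d ∧ support d = support a := by
  refine exists_nonneg_relation_support_eq fun i hi => ?_
  by_cases hbi : b i = 0
  · obtain ⟨d, hd, hd0, hdab, hdi⟩ := hw.exists_nonneg_of_pos hab (i := i)
      (by simpa [hbi] using (ha i).lt_of_ne' hi)
    refine ⟨d, hd, hd0, fun j hj haj => ?_, hdi⟩
    have h : 0 < a j - b j := hdab hj
    rw [haj, zero_sub, neg_pos] at h
    exact h.not_ge (hb j)
  · obtain ⟨c, hc, hcu, hci⟩ := exists_int_relation_of_ne_zero hu (i := i)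
      (mem_support.1 (hsupp ▸ ⟨hi, hbi⟩))
    obtain ⟨d, hd, hd0, hdc, hdi⟩ := hw.exists_nonneg_of_ne_zero hc hci
    exact ⟨d, hd, hd0, (hdc.trans (hcu.trans hsupp.subset)).trans Set.inter_subset_left, hdi⟩

end PositivelyDependent

end PositivelyDependent

section Characters

variable {G κ ι : Type*} [CommGroup G] [Fintype κ] [Fintype ι]

theorem prod_zpow_eq_zpow_sum {ι : Type*} (x : G) (I : Finset ι) (c : ι → ℤ) :
    ∏ i ∈ I, x ^ c i = x ^ ∑ i ∈ I, c i :=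
  congrArg Additive.toMul (Finset.sum_smul (x := Additive.ofMul x) (f := c) (s := I)).symm

/-- The value at the point `t` of a torus of the character with exponents `v`. -/
def torusChar (t : κ → G) (v : κ → ℤ) : G := ∏ j, t j ^ v j

theorem torusChar_neg (t : κ → G) (v : κ → ℤ) : torusChar t (-v) = (torusChar t v)⁻¹ := by
  simp [torusChar]

theorem torusChar_inv (t : κ → G) (v : κ → ℤ) : torusChar t⁻¹ v = (torusChar t v)⁻¹ := by
  simp [torusChar]

theorem torusChar_zpow_left (τ : G) (l v : κ → ℤ) :
    torusChar (fun j => τ ^ l j) v = τ ^ (l ⬝ᵥ v) := by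
  simp only [torusChar, dotProduct, ← zpow_mul, prod_zpow_eq_zpow_sum]

theorem prod_torusChar_zpow_eq_one {w : ι → κ → ℤ} {c : ι → ℤ} (hc : c ∈ relations ℤ w)
    (t : κ → G) : ∏ i, torusChar t (w i) ^ c i = 1 := by
  simp only [torusChar, ← Finset.prod_zpow, ← zpow_mul]
  rw [Finset.prod_comm]
  refine Finset.prod_eq_one fun j _ => ?_
  have hj : ∑ i, w i j * c i = 0 := by simpa [mul_comm] using mem_relations.1 hc j
  rw [prod_zpow_eq_zpow_sum, hj, zpow_zero]

theorem exists_comp_eq_of_baer {R M N Q : Type*} [CommRing R] [AddCommGroup M] [Module R M]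
    [AddCommGroup N] [Module R N] [AddCommGroup Q] [Module R Q] (hQ : Module.Baer R Q)
    (f : M →ₗ[R] N) (χ : M →ₗ[R] Q) (h : LinearMap.ker f ≤ LinearMap.ker χ) :
    ∃ g : N →ₗ[R] Q, g ∘ₗ f = χ := by
  obtain ⟨g, hg⟩ := hQ.extension_property ((LinearMap.ker f).liftQ f le_rfl)
    (LinearMap.ker_eq_bot.1 (Submodule.ker_liftQ_eq_bot' _ f rfl)) ((LinearMap.ker f).liftQ χ h)
  exact ⟨g, LinearMap.ext fun x => LinearMap.congr_fun hg (Submodule.Quotient.mk x)⟩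

variable {K : Type*} [Field K] [IsAlgClosed K]

theorem units_zpow_surjective {k : ℤ} (hk : k ≠ 0) : Function.Surjective fun x : Kˣ => x ^ k := by
  have hpow (y : Kˣ) : ∃ x : Kˣ, x ^ k.natAbs = y := by
    obtain ⟨z, hz⟩ := IsAlgClosed.exists_pow_nat_eq (y : K) (Int.natAbs_pos.2 hk)
    have hz0 : z ≠ 0 := ne_zero_pow (Int.natAbs_ne_zero.2 hk) (hz ▸ y.ne_zero)
    exact ⟨Units.mk0 z hz0, Units.ext hz⟩
  intro y
  rcases Int.natAbs_eq k with h | h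
  · obtain ⟨x, hx⟩ := hpow y
    exact ⟨x, by simp only; rw [h, zpow_natCast, hx]⟩
  · obtain ⟨x, hx⟩ := hpow y⁻¹
    exact ⟨x, by simp only; rw [h, zpow_neg, zpow_natCast, hx, inv_inv]⟩

theorem baer_additive_units : Module.Baer ℤ (Additive Kˣ) :=
  let _ : DivisibleBy (Additive Kˣ) ℤ := divisibleByOfSMulRightSurj _ _ units_zpow_surjective
  Module.Baer.of_divisible _

theorem exists_torusChar_eq {w : ι → κ → ℤ} {τ : ι → Kˣ} {S : Set ι}
    (h : ∀ c ∈ relationsOn ℤ w S, ∏ i, τ i ^ c i = 1) :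
    ∃ t : κ → Kˣ, ∀ i ∈ S, torusChar t (w i) = τ i := by
  classical
  let χ : (ι → ℤ) →ₗ[ℤ] Additive Kˣ := Fintype.linearCombination ℤ fun i => Additive.ofMul (τ i)
  have hw : relations ℤ w = LinearMap.ker (Fintype.linearCombination ℤ w) := rfl
  obtain ⟨g, hg⟩ := exists_comp_eq_of_baer baer_additive_units
    (Fintype.linearCombination ℤ w ∘ₗ (Pi.spanSubset ℤ S).subtype)
    (χ ∘ₗ (Pi.spanSubset ℤ S).subtype)
    fun c hc => (congrArg Additive.ofMul (h c ⟨hw ▸ hc, c.2⟩) : χ c = 0)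
  refine ⟨fun j => (g (Pi.single j 1)).toMul, fun i hi => ?_⟩
  have hmem : Pi.single i (1 : ℤ) ∈ Pi.spanSubset ℤ S := Pi.mem_spanSubset_iff.2 fun k hk =>
    Pi.single_eq_of_ne (ne_of_mem_of_not_mem hi hk).symm 1
  have hgi : g (w i) = Additive.ofMul (τ i) := by
    simpa [χ] using LinearMap.congr_fun hg ⟨_, hmem⟩
  calc torusChar (fun j => (g (Pi.single j 1)).toMul) (w i)
      = (g (∑ j, w i j • Pi.single j 1)).toMul := by
        simp only [torusChar, map_sum, map_smul, toMul_sum, toMul_zsmul]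
    _ = τ i := by rw [← pi_eq_sum_univ', hgi, toMul_ofMul]

theorem exists_support_eq_prod_zpow_eq {κ : Type*} [Finite κ] {c : κ → ι → ℤ}
    (hc : LinearIndependent ℤ c) {S : Set ι} (hcS : ∀ k, Function.support (c k) ⊆ S) (b : κ → Kˣ) :
    ∃ p : ι → K, Function.support p = S ∧ ∀ k, ∏ i, p i ^ c k i = b k := by
  classical
  cases nonempty_fintype κ
  obtain ⟨t, ht⟩ := exists_torusChar_eq (w := c) (τ := b) (S := Set.univ) fun d hd => by
    have hd0 := Fintype.linearIndependent_iff.1 hc d (mem_relationsOn.1 hd).1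
    simp [hd0]
  refine ⟨S.indicator fun i => t i, ?_, fun k => ?_⟩
  · rw [Set.support_indicator]
    exact Set.inter_eq_left.2 fun i _ => (t i).ne_zero
  · rw [← ht k trivial, torusChar, Units.coe_prod]
    refine Finset.prod_congr rfl fun i _ => ?_
    by_cases hi : i ∈ S
    · simp [hi]
    · simp [Function.notMem_support.1 (mt (@hcS k i) hi)]

end Characters

section PolyFun

open Function Polynomial

variable {K : Type*} [Field K] {W W₀ : Type*} [AddCommGroup W] [Module K W] [AddCommGroup W₀]
  [Module K W₀]

theorem dual_mem_polyFun (l : Module.Dual K W) : (l : W → K) ∈ polyFun K W :=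
  Algebra.subset_adjoin ⟨l, rfl⟩

theorem const_mem_polyFun (a : K) : (fun _ => a : W → K) ∈ polyFun K W :=
  (polyFun K W).algebraMap_mem a

variable (K) in
/-- A map between vector spaces is polynomial if it pulls back linear forms to polynomial
functions. -/
def IsPolyMap (g : W₀ → W) : Prop :=
  ∀ l : Module.Dual K W, (fun w => l (g w)) ∈ polyFun K W₀

theorem IsPolyMap.comp_mem {g : W₀ → W} (hg : IsPolyMap K g) {f : W → K} (hf : f ∈ polyFun K W) :
    f ∘ g ∈ polyFun K W₀ := by
  have hle : polyFun K W ≤ (polyFun K W₀).comap (AlgHom.pi fun w => Pi.evalAlgHom K _ (g w)) :=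
    Algebra.adjoin_le (by rintro _ ⟨l, rfl⟩; exact hg l)
  exact hle hf

/-- Pull-back of polynomial functions along a polynomial map. -/
def IsPolyMap.comap {g : W₀ → W} (hg : IsPolyMap K g) : polyFun K W →ₐ[K] polyFun K W₀ where
  toFun f := ⟨f.1 ∘ g, hg.comp_mem f.2⟩
  map_one' := rfl
  map_mul' _ _ := rfl
  map_zero' := rfl
  map_add' _ _ := rfl
  commutes' _ := rfl

theorem isPolyMap_const_add (x : W) (L : W₀ →ₗ[K] W) : IsPolyMap K fun w => x + L w := fun l => by
  simp only [map_add]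
  exact (polyFun K W₀).add_mem (const_mem_polyFun (l x)) (dual_mem_polyFun (l ∘ₗ L))

theorem isPolyMap_of_coord {ι : Type*} [Finite ι] (e : W ≃ₗ[K] (ι → K)) {g : W₀ → W}
    (hg : ∀ i, (fun w => e (g w) i) ∈ polyFun K W₀) : IsPolyMap K g := fun l => by
  classical
  cases nonempty_fintype ι
  have hl (w : W₀) : l (g w) = ∑ i, l (e.symm (Pi.single i 1)) * e (g w) i :=
    calc l (g w) = l (e.symm (∑ i, e (g w) i • Pi.single i 1)) := by
          rw [← pi_eq_sum_univ', e.symm_apply_apply]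
      _ = _ := by simp [mul_comm]
  simp only [hl]
  convert sum_mem fun i (_ : i ∈ Finset.univ) =>
    (polyFun K W₀).smul_mem (hg i) (l (e.symm (Pi.single i 1))) using 1
  funext w
  simp

theorem exists_eval_eq_of_mem_polyFun {f : K → K} (hf : f ∈ polyFun K K) :
    ∃ p : K[X], ∀ τ, f τ = p.eval τ := by
  have hle : polyFun K K ≤ (aeval (id : K → K)).range := by
    refine Algebra.adjoin_le ?_
    rintro _ ⟨l, rfl⟩
    refine ⟨X * C (l 1), funext fun τ => ?_⟩
    have hl : l τ = τ * l 1 := by rw [← smul_eq_mul, ← map_smul, smul_eq_mul, mul_one]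
    simp [hl]
  obtain ⟨p, rfl⟩ := hle hf
  exact ⟨p, fun τ => by simp [aeval_fn_apply]⟩

theorem apply_eq_zero_of_line [Infinite K] {ι : Type*} (I : Finset ι) (l : ι → Module.Dual K W)
    {x b : W} (hb : ∀ i ∈ I, l i b ≠ 0) {f : W → K} (hf : f ∈ polyFun K W)
    (h : ∀ τ : K, (∀ i ∈ I, l i (x + τ • b) ≠ 0) → f (x + τ • b) = 0) : f x = 0 := by
  obtain ⟨p, hp⟩ := exists_eval_eq_of_mem_polyFun
    ((isPolyMap_const_add x (LinearMap.toSpanSingleton K W b)).comp_mem hf)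
  simp only [comp_apply, LinearMap.toSpanSingleton_apply] at hp
  let q : K[X] := ∏ i ∈ I, (C (l i b) * X + C (l i x))
  have hq : q ≠ 0 := Finset.prod_ne_zero_iff.2 fun i hi h0 =>
    hb i hi (by simpa [coeff_X, coeff_C] using congrArg (coeff · 1) h0)
  have hpq : p * q = 0 := by
    refine Polynomial.funext fun τ => ?_
    rw [eval_mul, eval_zero, mul_eq_zero, or_iff_not_imp_right]
    intro hτ
    simp only [q, eval_prod, Finset.prod_ne_zero_iff] at hτ
    refine (hp τ).symm.trans (h τ fun i hi => ?_)
    rw [map_add, map_smul, smul_eq_mul, add_comm, mul_comm]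
    simpa using hτ i hi
  simpa [(mul_eq_zero.1 hpq).resolve_right hq] using hp 0

/-- Evaluation of polynomial functions at a point. -/
def evalAt (z : W) : polyFun K W →ₐ[K] K :=
  (Pi.evalAlgHom K (fun _ : W => K) z).comp (polyFun K W).val

@[simp]
theorem evalAt_apply (z : W) (f : polyFun K W) : evalAt z f = f.1 z := rfl

end PolyFun

section Dimension

variable {K W W₀ : Type u} [Field K] [AddCommGroup W] [Module K W] [AddCommGroup W₀]
  [Module K W₀]

theorem trdeg_polyFun_le [FiniteDimensional K W] :
    Algebra.trdeg K (polyFun K W) ≤ Module.finrank K W := by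
  let b := Module.finBasis K W
  let φ : MvPolynomial (Fin (Module.finrank K W)) K →ₐ[K] (W → K) :=
    MvPolynomial.aeval fun i w => b.coord i w
  have hle : polyFun K W ≤ φ.range := by
    refine Algebra.adjoin_le ?_
    rintro _ ⟨l, rfl⟩
    refine ⟨∑ i, MvPolynomial.C (l (b i)) * MvPolynomial.X i, funext fun w => ?_⟩
    change φ _ w = l w
    conv_rhs => rw [← b.sum_repr w, map_sum]
    simp [φ, mul_comm]
  calc Algebra.trdeg K (polyFun K W) ≤ Algebra.trdeg K φ.range :=
        trdeg_le_of_injective (Subalgebra.inclusion hle) (Subalgebra.inclusion_injective hle)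
    _ ≤ Algebra.trdeg K (MvPolynomial (Fin (Module.finrank K W)) K) :=
        trdeg_le_of_surjective φ.rangeRestrict φ.rangeRestrict_surjective
    _ = Module.finrank K W := by simp [MvPolynomial.trdeg_of_isDomain]

theorem trdeg_le_of_slice [FiniteDimensional K W₀] (A : Subalgebra K (polyFun K W)) {g : W₀ → W}
    (hg : IsPolyMap K g) (h : ∀ f ∈ A, (∀ w, f.1 (g w) = 0) → f = 0) :
    Algebra.trdeg K A ≤ Module.finrank K W₀ := by
  refine (trdeg_le_of_injective (hg.comap.comp A.val) ?_).trans trdeg_polyFun_le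
  refine (injective_iff_map_eq_zero _).2 fun f hf => Subtype.ext ?_
  exact h f.1 f.2 fun w => congrFun (congrArg Subtype.val hf) w

theorem algebraicIndependent_of_eval {K ι J A : Type*} [Field K] [Infinite K] [Finite ι] [Finite J]
    [CommRing A] [Algebra K A] {f : ι → A} {l : J → Module.Dual K (ι → K)} (hl : ∀ j, l j ≠ 0)
    (h : ∀ a, (∀ j, l j a ≠ 0) → ∃ ε : A →ₐ[K] K, ∀ i, ε (f i) = a i) :
    AlgebraicIndependent K f := by
  classical
  cases nonempty_fintype ι
  cases nonempty_fintype J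
  let L (j : J) : MvPolynomial ι K :=
    ∑ i, MvPolynomial.C (l j (Pi.single i 1)) * MvPolynomial.X i
  have hL (j : J) (a : ι → K) : MvPolynomial.eval a (L j) = l j a := by
    conv_rhs => rw [pi_eq_sum_univ' a]
    simp [L, mul_comm]
  have hP : ∏ j, L j ≠ 0 := Finset.prod_ne_zero_iff.2 fun j _ h0 =>
    hl j (LinearMap.ext fun a => by rw [← hL, h0, map_zero, LinearMap.zero_apply])
  refine algebraicIndependent_iff.2 fun p hp => ?_
  suffices hpP : p * ∏ j, L j = 0 from (mul_eq_zero.1 hpP).resolve_right hP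
  refine MvPolynomial.funext fun a => ?_
  rw [map_mul, map_zero, mul_eq_zero, or_iff_not_imp_right, map_prod, Finset.prod_eq_zero_iff]
  intro ha
  obtain ⟨ε, hε⟩ := h a fun j hj => ha ⟨j, Finset.mem_univ j, (hL j a).trans hj⟩
  calc MvPolynomial.eval a p = ε (MvPolynomial.aeval f p) := by
        rw [← AlgHom.comp_apply, MvPolynomial.comp_aeval, funext hε, MvPolynomial.aeval_eq_eval]
    _ = 0 := by rw [hp, map_zero]

theorem card_le_finrank_of_dominant {ι : Type*} [Fintype ι] [Infinite K] [FiniteDimensional K W]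
    (f : ι → polyFun K W) (h : ∀ a : ι → K, (∀ i, a i ≠ 0) → ∃ z, ∀ i, (f i).1 z = a i) :
    Fintype.card ι ≤ Module.finrank K W := by
  have hf : AlgebraicIndependent K f :=
    algebraicIndependent_of_eval (l := LinearMap.proj)
      (fun i h0 => one_ne_zero (LinearMap.congr_fun h0 1)) fun a ha => by
        obtain ⟨z, hz⟩ := h a ha
        exact ⟨evalAt z, hz⟩
  have hle := hf.lift_cardinalMk_le_trdeg.trans (Cardinal.lift_le.2 trdeg_polyFun_le)
  rw [Cardinal.mk_fintype, Cardinal.lift_natCast, Cardinal.lift_natCast] at hle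
  exact_mod_cast hle

theorem card_le_finrank_of_prod_zpow_surjective {ι κ : Type*} [Fintype ι] [Fintype κ] [Infinite K]
    [FiniteDimensional K W] (X : ι → Module.Dual K W) (c : κ → ι → ℤ)
    (h : ∀ b : κ → Kˣ, ∃ q, ∀ k, ∏ i, X i q ^ c k i = b k) :
    Fintype.card κ ≤ Module.finrank K W := by
  let N (i : ι) : ℕ := ∑ k, (c k i).natAbs
  have hcN (k : κ) (i : ι) : (c k i).natAbs ≤ N i :=
    Finset.single_le_sum (f := fun k => (c k i).natAbs) (by simp) (Finset.mem_univ k)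
  let lin (l : Module.Dual K (K × W)) : polyFun K (K × W) := ⟨l, dual_mem_polyFun l⟩
  -- The extra coordinate clears the denominators of the characters.
  let f (o : Option κ) : polyFun K (K × W) := lin (LinearMap.fst K K W) *
    ∏ i, lin (X i ∘ₗ LinearMap.snd K K W) ^ (N i + o.elim 0 (c · i)).toNat
  have hf (o : Option κ) (q : K × W) :
      (f o).1 q = q.1 * ∏ i, X i q.2 ^ (N i + o.elim 0 (c · i)).toNat := by
    rw [← evalAt_apply]
    simp [f, lin]
  have hcard := card_le_finrank_of_dominant f fun a ha => by
    obtain ⟨q, hq⟩ := h fun k => Units.mk0 (a (some k)) (ha _) / Units.mk0 (a none) (ha _)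
    have hq_ne (i : ι) (hi : N i ≠ 0) : X i q ≠ 0 := fun hqi => by
      obtain ⟨k, -, hk⟩ := Finset.exists_ne_zero_of_sum_ne_zero hi
      refine (Units.ne_zero _) ((hq k).symm.trans (Finset.prod_eq_zero (Finset.mem_univ i) ?_))
      rw [hqi, zero_zpow _ (Int.natAbs_ne_zero.1 hk)]
    have hD : ∏ i, X i q ^ N i ≠ 0 := Finset.prod_ne_zero_iff.2 fun i _ => by
      by_cases hi : N i = 0
      · simp [hi]
      · exact pow_ne_zero _ (hq_ne i hi)
    have hpow (k : κ) (i : ι) : X i q ^ (N i + c k i).toNat = X i q ^ N i * X i q ^ c k i := by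
      have hki := hcN k i
      by_cases hi : N i = 0
      · simp [hi, show c k i = 0 by omega]
      · rw [← zpow_natCast, ← zpow_natCast, ← zpow_add₀ (hq_ne i hi)]
        congr 1
        omega
    refine ⟨(a none / ∏ i, X i q ^ N i, q), Option.forall.2 ⟨?_, fun k => ?_⟩⟩
    · simp [hf, hD]
    · have ha0 := ha none
      simp only [hf, Option.elim_some, hpow, Finset.prod_mul_distrib, hq k,
        Units.val_div_eq_div_val, Units.val_mk0]
      field_simp
  simpa [add_comm] using hcard

end Dimension

section ZariskiClosure

variable {K : Type*} [Field K] {W : Type*} [AddCommGroup W] [Module K W] {Z : Set W}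

theorem subset_zariskiClosure (Z : Set W) : Z ⊆ zariskiClosure K Z := fun z hz _ hf => hf z hz

theorem IsZariskiClosed.zariskiClosure_eq (hZ : IsZariskiClosed K Z) : zariskiClosure K Z = Z := by
  refine Set.Subset.antisymm ?_ (subset_zariskiClosure Z)
  obtain ⟨F, rfl⟩ := hZ
  exact fun z hz f hf => hz f fun y hy => hy f hf

theorem isZariskiClosed_of_zariskiClosure_subset (hZ : zariskiClosure K Z ⊆ Z) :
    IsZariskiClosed K Z :=
  ⟨{f | ∀ z ∈ Z, f.1 z = 0}, Set.Subset.antisymm (subset_zariskiClosure Z) hZ⟩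

theorem eq_of_mem_zariskiClosure {x : W} (hx : x ∈ zariskiClosure K Z) {a : K} (f : polyFun K W)
    (hf : ∀ z ∈ Z, f.1 z = a) : f.1 x = a :=
  sub_eq_zero.1 (hx (f - algebraMap K _ a) fun z hz => sub_eq_zero.2 (hf z hz))

end ZariskiClosure

section Monomials

open Function

variable {K ι : Type*} [Field K] [Fintype ι]

theorem prod_zpow_ne_zero_iff {c : ι → ℤ} {z : ι → K} :
    ∏ i, z i ^ c i ≠ 0 ↔ support c ⊆ support z := by
  simp only [Finset.prod_ne_zero_iff, Finset.mem_univ, true_imp_iff, Set.subset_def, mem_support]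
  refine forall_congr' fun i => ⟨fun h hci hzi => h (by rw [hzi, zero_zpow _ hci]), fun h hzi => ?_⟩
  have hci : c i ≠ 0 := fun hci => one_ne_zero ((zpow_zero (z i)).symm.trans (hci ▸ hzi))
  exact zpow_ne_zero _ (h hci) hzi

theorem prod_zpow_mul_prod_pow {c : ι → ℤ} {z : ι → K} (hz : support c ⊆ support z) :
    (∏ i, z i ^ c i) * ∏ i, z i ^ (-c i).toNat = ∏ i, z i ^ (c i).toNat := by
  rw [← Finset.prod_mul_distrib]
  refine Finset.prod_congr rfl fun i _ => ?_
  by_cases hi : c i = 0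
  · simp [hi]
  · rw [← zpow_natCast, ← zpow_natCast, ← zpow_add₀ (hz hi)]
    congr 1
    omega

theorem prod_pow_toNat_neg_ne_zero {c : ι → ℤ} {z : ι → K} (hz : support c ⊆ support z) :
    ∏ i, z i ^ (-c i).toNat ≠ 0 := by
  refine Finset.prod_ne_zero_iff.2 fun i _ => ?_
  by_cases hi : c i = 0
  · simp [hi]
  · exact pow_ne_zero _ (hz hi)

variable {W : Type*} [AddCommGroup W] [Module K W]

/-- The monomial with exponents `m` in the coordinates `e`. -/
def monomialFun (e : W ≃ₗ[K] (ι → K)) (m : ι → ℕ) : polyFun K W :=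
  ∏ i, ⟨fun x => e x i, dual_mem_polyFun (LinearMap.proj i ∘ₗ e.toLinearMap)⟩ ^ m i

theorem monomialFun_apply (e : W ≃ₗ[K] (ι → K)) (m : ι → ℕ) (x : W) :
    (monomialFun e m).1 x = ∏ i, e x i ^ m i := by
  rw [← evalAt_apply, monomialFun, map_prod]
  simp

end Monomials

section Diagonal

open Function

variable {K W ι κ : Type*} [Field K] [AddCommGroup W] [Module K W] [Fintype κ]
  {w : ι → κ → ℤ} {ρ : Representation K (κ → Kˣ) W} {e : W ≃ₗ[K] (ι → K)} {x z : W}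

/-- In the coordinates `e`, the torus acts diagonally with weights `w`. -/
def IsDiagonal (ρ : Representation K (κ → Kˣ) W) (e : W ≃ₗ[K] (ι → K)) (w : ι → κ → ℤ) : Prop :=
  ∀ t x i, e (ρ t x) i = (torusChar t (w i) : Kˣ) * e x i

/-- The limit `lim_{τ → 0} λ(τ) x` along the one-parameter subgroup `λ(τ) = (τ ^ l j)_j`. It exists
if `l ⬝ᵥ w i` is nonnegative on the support of `x`. -/
def limitPt (e : W ≃ₗ[K] (ι → K)) (w : ι → κ → ℤ) (l : κ → ℤ) (x : W) : W :=
  e.symm ({i | l ⬝ᵥ w i = 0}.indicator (e x))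

theorem support_coord_limitPt (l : κ → ℤ) (x : W) :
    support (e (limitPt e w l x)) = {i | l ⬝ᵥ w i = 0} ∩ support (e x) := by
  rw [limitPt, e.apply_symm_apply, Set.support_indicator]

theorem IsDiagonal.support_coord_eq (h : IsDiagonal ρ e w) (hz : z ∈ repOrbit ρ x) :
    support (e z) = support (e x) := by
  obtain ⟨t, rfl⟩ := hz
  ext i
  simp [h t x i]

theorem IsDiagonal.support_coord_subset (h : IsDiagonal ρ e w)
    (hz : z ∈ zariskiClosure K (repOrbit ρ x)) :
    support (e z) ⊆ support (e x) := fun i hi hxi =>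
  hi <| eq_of_mem_zariskiClosure hz ⟨_, dual_mem_polyFun (LinearMap.proj i ∘ₗ e.toLinearMap)⟩
    fun y hy => notMem_support.1 (h.support_coord_eq hy ▸ notMem_support.2 hxi : i ∉ support (e y))

theorem IsDiagonal.limitPt_mem_closure [Finite ι] [Infinite K] (h : IsDiagonal ρ e w) {l : κ → ℤ}
    (hl : ∀ i ∈ support (e x), 0 ≤ l ⬝ᵥ w i) :
    limitPt e w l x ∈ zariskiClosure K (repOrbit ρ x) := by
  intro f hf
  let γ (τ : K) : W := e.symm fun i => τ ^ (l ⬝ᵥ w i).toNat * e x i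
  have hγ : IsPolyMap K γ := isPolyMap_of_coord e fun i => by
    simp only [γ, e.apply_symm_apply]
    exact (polyFun K K).mul_mem ((polyFun K K).pow_mem (dual_mem_polyFun LinearMap.id) _)
      (const_mem_polyFun (e x i))
  have hγ_zero : γ 0 = limitPt e w l x := congrArg e.symm <| funext fun i => by
    by_cases hi : e x i = 0
    · rw [hi, mul_zero, Set.indicator_apply_eq_zero.2 fun _ => hi]
    · by_cases hli : l ⬝ᵥ w i = 0
      · rw [Set.indicator_of_mem (by exact hli), hli, Int.toNat_zero, pow_zero, one_mul]
      · rw [Set.indicator_of_notMem (by exact hli), zero_pow, zero_mul]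
        have := hl i hi
        omega
  have hγ_unit (τ : Kˣ) : γ τ = ρ (fun j => τ ^ l j) x := e.injective <| funext fun i => by
    rw [h, torusChar_zpow_left, e.apply_symm_apply]
    by_cases hi : e x i = 0
    · rw [hi, mul_zero, mul_zero]
    · rw [Units.val_zpow_eq_zpow_val, ← zpow_natCast, Int.toNat_of_nonneg (hl i hi)]
  rw [← hγ_zero]
  refine apply_eq_zero_of_line {()} (fun _ => LinearMap.id) (b := (1 : K)) (by simp)
    (hγ.comp_mem f.2) fun τ hτ => ?_
  obtain ⟨τ', hτ'⟩ : IsUnit ((0 : K) + τ • 1) := isUnit_iff_ne_zero.2 (hτ () (by simp))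
  rw [← hτ', comp_apply, hγ_unit]
  exact hf _ ⟨_, rfl⟩

theorem IsDiagonal.apply_limitPt_eq [Finite ι] [Infinite K] (h : IsDiagonal ρ e w) {f : polyFun K W}
    (hf : f ∈ invariantFun ρ) {l : κ → ℤ} (hl : ∀ i ∈ support (e x), 0 ≤ l ⬝ᵥ w i) :
    f.1 (limitPt e w l x) = f.1 x :=
  eq_of_mem_zariskiClosure (h.limitPt_mem_closure hl) f
    (by rintro _ ⟨t, rfl⟩; exact congrFun (congrArg Subtype.val (hf t)) x)

variable [Fintype ι]

namespace IsDiagonal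

variable (h : IsDiagonal ρ e w)
include h

theorem monomialFun_apply (m : ι → ℕ) (t : κ → Kˣ) (x : W) :
    (monomialFun e m).1 (ρ t x) =
      (∏ i, ((torusChar t (w i) : Kˣ) : K) ^ m i) * (monomialFun e m).1 x := by
  simp only [MomentTorus.monomialFun_apply, h t x, mul_pow, Finset.prod_mul_distrib]

theorem binomial_of_mem_closure (hz : z ∈ zariskiClosure K (repOrbit ρ x)) {c : ι → ℤ}
    (hc : c ∈ relations ℤ w) :
    (∏ i, e z i ^ (c i).toNat) * ∏ i, e x i ^ (-c i).toNat =
      (∏ i, e z i ^ (-c i).toNat) * ∏ i, e x i ^ (c i).toNat := by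
  let f := monomialFun e fun i => (c i).toNat
  let g := monomialFun e fun i => (-c i).toNat
  have hfg := eq_of_mem_zariskiClosure (a := 0) hz (g.1 x • f - f.1 x • g) (by
    rintro _ ⟨t, rfl⟩
    have hχ := prod_zpow_mul_prod_pow (c := c) (z := fun i => ((torusChar t (w i) : Kˣ) : K))
      fun i _ => Units.ne_zero _
    have hχ_one := congrArg Units.val (prod_torusChar_zpow_eq_one hc t)
    push_cast at hχ_one
    rw [hχ_one, one_mul] at hχ
    change g.1 x * f.1 (ρ t x) - f.1 x * g.1 (ρ t x) = 0
    rw [h.monomialFun_apply, h.monomialFun_apply, hχ]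
    ring)
  replace hfg : g.1 x * f.1 z - f.1 x * g.1 z = 0 := hfg
  simp only [f, g, MomentTorus.monomialFun_apply] at hfg
  linear_combination hfg

theorem prod_zpow_eq_of_mem_closure (hz : z ∈ zariskiClosure K (repOrbit ρ x)) {c : ι → ℤ}
    (hc : c ∈ relations ℤ w) (hcz : support c ⊆ support (e z)) :
    ∏ i, e z i ^ c i = ∏ i, e x i ^ c i := by
  have hcx := hcz.trans (h.support_coord_subset hz)
  have hb := h.binomial_of_mem_closure hz hc
  rw [← prod_zpow_mul_prod_pow hcz, ← prod_zpow_mul_prod_pow hcx] at hb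
  refine mul_right_cancel₀ (mul_ne_zero (prod_pow_toNat_neg_ne_zero hcz)
    (prod_pow_toNat_neg_ne_zero hcx)) ?_
  linear_combination hb

theorem support_subset_of_mem_closure (hz : z ∈ zariskiClosure K (repOrbit ρ x)) {a : ι → ℤ}
    (ha : a ∈ relations ℤ w) (ha0 : 0 ≤ a) (hax : support a ⊆ support (e x)) :
    support a ⊆ support (e z) := by
  have htoNat (i : ι) : (((a i).toNat : ℕ) : ℤ) = a i := Int.toNat_of_nonneg (ha0 i)
  have hneg (i : ι) : (-a i).toNat = 0 := Int.toNat_of_nonpos (neg_nonpos.2 (ha0 i))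
  have hb := h.binomial_of_mem_closure hz ha
  simp only [hneg, pow_zero, Finset.prod_const_one, mul_one, one_mul] at hb
  simp only [← zpow_natCast, htoNat] at hb
  exact prod_zpow_ne_zero_iff.1 (hb ▸ prod_zpow_ne_zero_iff.2 hax)

theorem mem_orbit [IsAlgClosed K] (hzx : support (e z) = support (e x))
    (hb : ∀ c ∈ relationsOn ℤ w (support (e x)), ∏ i, e z i ^ c i = ∏ i, e x i ^ c i) :
    z ∈ repOrbit ρ x := by
  classical
  let τ (i : ι) : Kˣ := if hi : e z i / e x i = 0 then 1 else Units.mk0 (e z i / e x i) hi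
  have hτ (i : ι) (hi : e x i ≠ 0) : (τ i : K) = e z i / e x i := by
    have hzi : e z i ≠ 0 := hzx.symm.subset hi
    simp [τ, hi, hzi]
  obtain ⟨t, ht⟩ := exists_torusChar_eq (w := w) (τ := τ) (S := support (e x)) fun c hc => by
    have hcx := (mem_relationsOn.1 hc).2
    refine Units.ext ?_
    push_cast
    calc ∏ i, (τ i : K) ^ c i = (∏ i, e z i ^ c i) / ∏ i, e x i ^ c i := by
          rw [← Finset.prod_div_distrib]
          refine Finset.prod_congr rfl fun i _ => ?_
          by_cases hi : c i = 0
          · simp [hi]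
          · rw [hτ i (hcx hi), div_zpow]
      _ = 1 := by rw [hb c hc, div_self (prod_zpow_ne_zero_iff.2 hcx)]
  refine ⟨t, e.injective (funext fun i => ?_)⟩
  rw [h]
  by_cases hi : e x i = 0
  · have hzi : e z i = 0 := notMem_support.1 (hzx ▸ notMem_support.2 hi)
    rw [hi, hzi, mul_zero]
  · rw [ht i hi, hτ i hi, div_mul_cancel₀ _ hi]

theorem isSemisimpleElt_iff [IsAlgClosed K] (x : W) :
    IsSemisimpleElt ρ x ↔ ∃ a ∈ relations ℤ w, 0 ≤ a ∧ support a = support (e x) := by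
  constructor
  · intro hx
    obtain ⟨a, ha, l, ha0, hax, hla, hlx⟩ :=
      exists_nonneg_relation_dotProduct_complementary w (support (e x))
    have hl (i : ι) (hi : i ∈ support (e x)) : 0 ≤ l ⬝ᵥ w i := by
      by_cases hai : i ∈ support a
      · exact (hla i hai).ge
      · exact (hlx i ⟨hi, hai⟩).le
    have hlim := h.limitPt_mem_closure hl
    rw [hx.zariskiClosure_eq] at hlim
    have hsupp := (support_coord_limitPt l x).symm.trans (h.support_coord_eq hlim)
    refine ⟨a, ha, ha0, hax.antisymm fun i hi => by_contra fun hai => ?_⟩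
    exact (hlx i ⟨hi, hai⟩).ne' (hsupp.symm.subset hi).1
  · rintro ⟨a, ha, ha0, hax⟩
    refine isZariskiClosed_of_zariskiClosure_subset fun z hz => ?_
    have hzx : support (e z) = support (e x) := (h.support_coord_subset hz).antisymm
      (hax ▸ h.support_subset_of_mem_closure hz ha ha0 hax.subset)
    refine h.mem_orbit hzx fun c hc => ?_
    obtain ⟨hc, hcx⟩ := mem_relationsOn.1 hc
    exact h.prod_zpow_eq_of_mem_closure hz hc (hzx ▸ hcx)

end IsDiagonal

end Diagonal

section Visible

open Function

variable {K W ι κ : Type*} [Field K] [IsAlgClosed K] [AddCommGroup W] [Module K W] [Fintype ι]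
  [Fintype κ] {w : ι → κ → ℤ} {ρ : Representation K (κ → Kˣ) W} {e : W ≃ₗ[K] (ι → K)}

namespace IsDiagonal

variable (h : IsDiagonal ρ e w)
include h

theorem isNilpotentElt_iff {x : W} : IsNilpotentElt ρ x ↔
    ∀ a ∈ relations ℤ w, 0 ≤ a → support a ⊆ support (e x) → a = 0 := by
  constructor
  · intro hx a ha ha0 hax
    have hae := h.support_subset_of_mem_closure hx ha ha0 hax
    rw [map_zero, support_zero, Set.subset_empty_iff] at hae
    exact support_eq_empty_iff.1 hae
  · intro hx
    obtain ⟨a, ha, l, ha0, hax, -, hlx⟩ :=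
      exists_nonneg_relation_dotProduct_complementary w (support (e x))
    rw [hx a ha ha0 hax, support_zero, Set.sdiff_empty] at hlx
    have hlim : limitPt e w l x = 0 := by
      refine e.map_eq_zero_iff.1 (support_eq_empty_iff.1 ?_)
      rw [support_coord_limitPt]
      exact Set.eq_empty_of_forall_notMem fun i hi => (hlx i hi.2).ne' hi.1
    rw [IsNilpotentElt, ← hlim]
    exact h.limitPt_mem_closure fun i hi => (hlx i hi).le

theorem infinite_orbits_support_eq {c : ι → ℤ} (hc : c ∈ relations ℤ w) (hc_ne : c ≠ 0) :
    {O | ∃ x, support (e x) = support c ∧ O = repOrbit ρ x}.Infinite := by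
  have : Infinite Kˣ := unitsEquivNeZero.infinite_iff.2
    (Set.infinite_coe_iff.2 (Set.finite_singleton (0 : K)).infinite_compl)
  have hind : LinearIndependent ℤ fun _ : Unit => c := LinearIndependent.of_subsingleton () hc_ne
  choose p hp hpc using fun b : Kˣ =>
    exists_support_eq_prod_zpow_eq hind (fun _ => le_rfl) fun _ => b
  have hsupp (b : Kˣ) : support (e (e.symm (p b))) = support c := by rw [e.apply_symm_apply, hp]
  refine Set.infinite_of_injective_forall_mem (f := fun b => repOrbit ρ (e.symm (p b))) ?_
    fun b => ⟨_, hsupp b, rfl⟩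
  intro b b' hbb'
  have hmem : e.symm (p b) ∈ repOrbit ρ (e.symm (p b')) := hbb'.subset ⟨1, by simp⟩
  have hprod := h.prod_zpow_eq_of_mem_closure (subset_zariskiClosure _ hmem) hc (hsupp b).ge
  simp only [e.apply_symm_apply, hpc _ ()] at hprod
  exact Units.ext hprod

theorem orbit_eq_of_relationsOn_eq_bot {x : W} (hx : relationsOn ℤ w (support (e x)) = ⊥) :
    repOrbit ρ x = {z | support (e z) = support (e x)} := by
  refine Set.Subset.antisymm (fun z hz => h.support_coord_eq hz) fun z hz =>
    h.mem_orbit hz fun c hc => ?_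
  rw [hx, Submodule.mem_bot] at hc
  simp [hc]

theorem isVisible_iff : IsVisible ρ ↔ PositivelyDependent w := by
  constructor
  · intro hvis c hc hc_ne
    by_contra! hcon
    refine h.infinite_orbits_support_eq hc hc_ne (hvis.subset ?_)
    rintro _ ⟨x, hx, rfl⟩
    refine ⟨x, h.isNilpotentElt_iff.2 fun a ha ha0 hax => ?_, rfl⟩
    exact by_contra fun ha_ne => hcon a ha ha_ne ha0 (hx ▸ hax)
  · intro hw
    refine (Set.finite_range fun S : Set ι => {z | support (e z) = S}).subset ?_
    rintro _ ⟨x, hx, rfl⟩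
    refine ⟨_, (h.orbit_eq_of_relationsOn_eq_bot ((Submodule.eq_bot_iff _).2 fun c hc => ?_)).symm⟩
    obtain ⟨hc, hcx⟩ := mem_relationsOn.1 hc
    by_contra hc_ne
    obtain ⟨a, ha, ha_ne, ha0, hac⟩ := hw c hc hc_ne
    exact ha_ne (h.isNilpotentElt_iff.1 hx a ha ha0 (hac.trans hcx))

end IsDiagonal

end Visible

section NullFibre

open Function

variable {K : Type*} [Field K] {r n : ℕ} {s : Fin n → Fin r → ℤ}

variable (K n) in
/-- The coordinates of a linear form on `K ^ n`. -/
def dualCoord : Module.Dual K (Fin n → K) ≃ₗ[K] (Fin n → K) :=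
  (dotProductEquiv K (Fin n)).symm

theorem dualCoord_apply (y : Module.Dual K (Fin n → K)) (i : Fin n) :
    dualCoord K n y i = y (Pi.single i 1) := rfl

theorem apply_eq_sum_dualCoord (y : Module.Dual K (Fin n → K)) (x : Fin n → K) :
    y x = ∑ i, x i * dualCoord K n y i := by
  conv_lhs => rw [← (dualCoord K n).symm_apply_apply y]
  exact dotProduct_comm (dualCoord K n y) x

variable (K n) in
/-- The coordinates on `V ⊕ V*` for `V = K ^ n`. -/
def prodCoord : ((Fin n → K) × Module.Dual K (Fin n → K)) ≃ₗ[K] (Fin n ⊕ Fin n → K) :=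
  ((LinearEquiv.refl K (Fin n → K)).prodCongr (dualCoord K n)).trans
    (LinearEquiv.sumArrowLequivProdArrow (Fin n) (Fin n) K K).symm

theorem prodCoord_apply (z : (Fin n → K) × Module.Dual K (Fin n → K)) :
    prodCoord K n z = Sum.elim z.1 (dualCoord K n z.2) := rfl

theorem isDiagonal_torusRep (s : Fin n → Fin r → ℤ) :
    IsDiagonal (torusRep K s) (LinearEquiv.refl K (Fin n → K)) s := fun _ _ _ => rfl

theorem isDiagonal_dual (s : Fin n → Fin r → ℤ) :
    IsDiagonal (torusRep K s).dual (dualCoord K n) (-s) := fun t y i => by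
  have hti : torusRep K s t⁻¹ (Pi.single i 1) =
      (torusChar t (-s i) : Kˣ) • Pi.single i (1 : K) := by
    funext k
    refine (isDiagonal_torusRep s t⁻¹ _ k).trans ?_
    rw [torusChar_inv, ← torusChar_neg]
    by_cases hk : k = i
    · subst hk; rfl
    · simp [hk]
  rw [dualCoord_apply, dualCoord_apply, Representation.dual_apply, Module.Dual.transpose_apply,
    LinearMap.comp_apply, hti, Units.smul_def, map_smul]
  rfl

theorem isDiagonal_doubleRep (s : Fin n → Fin r → ℤ) :
    IsDiagonal (doubleRep (torusRep K s)) (prodCoord K n) (Sum.elim s (-s)) := by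
  rintro t z (i | i)
  · exact isDiagonal_torusRep s t z.1 i
  · exact isDiagonal_dual s t z.2 i

theorem relations_neg (R : Type*) [CommRing R] {ι κ : Type*} [Fintype ι] (w : ι → κ → ℤ) :
    relations R (-w) = relations R w := by
  ext u
  simp [mem_relations]

theorem sumElim_mem_relations_iff {R ι κ : Type*} [CommRing R] [Fintype ι] {w : ι → κ → ℤ}
    {a b : ι → R} : Sum.elim a b ∈ relations R (Sum.elim w (-w)) ↔ a - b ∈ relations R w := by
  simp [mem_relations, sub_mul, Finset.sum_sub_distrib, Fintype.sum_sum_type, ← sub_eq_add_neg]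

theorem mem_nullFibre_iff {z : (Fin n → K) × Module.Dual K (Fin n → K)} :
    z ∈ nullFibre (torusLie K s) ↔ z.1 * dualCoord K n z.2 ∈ relations K s := by
  have hμ (j : Fin r) : momentMap (torusLie K s) z (Pi.single j 1) =
      ∑ i, (z.1 * dualCoord K n z.2) i * (s i j : K) := by
    change z.2 (torusLie K s (Pi.single j 1) z.1) = _
    rw [apply_eq_sum_dualCoord]
    refine Finset.sum_congr rfl fun i _ => ?_
    have hij : ∑ k, (s i k : K) * (Pi.single j 1 : Fin r → K) k = s i j := by simp [Pi.single_apply]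
    simp only [torusLie, LinearMap.mk₂_apply, hij, Pi.mul_apply]
    ring
  rw [mem_relations]
  simp only [← hμ]
  exact ⟨fun hz j => LinearMap.congr_fun hz (Pi.single j 1), fun hz =>
    LinearMap.pi_ext' fun j => LinearMap.ext_ring (hz j)⟩

/-- The point `(p, u / p)`. It lies in the null fibre if `u` is a relation with the same support as
`p`. -/
def relPoint (u p : Fin n → K) : (Fin n → K) × Module.Dual K (Fin n → K) :=
  (p, (dualCoord K n).symm (u / p))

theorem relPoint_mem_nullFibre {u p : Fin n → K} (hu : u ∈ relations K s)
    (hp : support p = support u) : relPoint u p ∈ nullFibre (torusLie K s) := by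
  rw [mem_nullFibre_iff, relPoint, LinearEquiv.apply_symm_apply]
  convert hu using 1
  funext i
  refine mul_div_cancel_of_imp' fun hi => ?_
  rwa [← notMem_support, ← hp, notMem_support]

theorem repOrbit_doubleRep_fst {G V : Type*} [Group G] [AddCommGroup V] [Module K V]
    (ρ : Representation K G V) (z : V × Module.Dual K V) :
    Prod.fst '' repOrbit (doubleRep ρ) z = repOrbit ρ z.1 := by
  rw [repOrbit, repOrbit, ← Set.range_comp]
  rfl

variable [IsAlgClosed K]

theorem isSemisimpleElt_torusRep_iff {x : Fin n → K} :
    IsSemisimpleElt (torusRep K s) x ↔ ∃ a ∈ relations ℤ s, 0 ≤ a ∧ support a = support x :=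
  (isDiagonal_torusRep s).isSemisimpleElt_iff x

theorem isSemisimpleElt_dual_iff {y : Module.Dual K (Fin n → K)} :
    IsSemisimpleElt (torusRep K s).dual y ↔
      ∃ a ∈ relations ℤ s, 0 ≤ a ∧ support a = support (dualCoord K n y) := by
  rw [(isDiagonal_dual s).isSemisimpleElt_iff, relations_neg]

theorem isSemisimpleElt_doubleRep_iff {z : (Fin n → K) × Module.Dual K (Fin n → K)} :
    IsSemisimpleElt (doubleRep (torusRep K s)) z ↔ ∃ a b : Fin n → ℤ, a - b ∈ relations ℤ s ∧
      0 ≤ a ∧ 0 ≤ b ∧ support a = support z.1 ∧ support b = support (dualCoord K n z.2) := by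
  rw [(isDiagonal_doubleRep s).isSemisimpleElt_iff]
  have hsupp (a b : Fin n → ℤ) : support (Sum.elim a b) = support (prodCoord K n z) ↔
      support a = support z.1 ∧ support b = support (dualCoord K n z.2) := by
    simp only [Set.ext_iff, mem_support, Sum.forall, prodCoord_apply, Sum.elim_inl, Sum.elim_inr]
  constructor
  · rintro ⟨a, ha, ha0, haz⟩
    rw [← Sum.elim_comp_inl_inr a] at ha haz
    exact ⟨_, _, sumElim_mem_relations_iff.1 ha, fun i => ha0 _, fun i => ha0 _, (hsupp _ _).1 haz⟩
  · rintro ⟨a, b, hab, ha0, hb0, hz⟩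
    exact ⟨Sum.elim a b, sumElim_mem_relations_iff.2 hab, Sum.forall.2 ⟨ha0, hb0⟩, (hsupp a b).2 hz⟩

theorem isSemisimpleElt_doubleRep_of {x : Fin n → K} {y : Module.Dual K (Fin n → K)}
    (hx : IsSemisimpleElt (torusRep K s) x) (hy : IsSemisimpleElt (torusRep K s).dual y) :
    IsSemisimpleElt (doubleRep (torusRep K s)) (x, y) := by
  obtain ⟨a, ha, ha0, hax⟩ := isSemisimpleElt_torusRep_iff.1 hx
  obtain ⟨b, hb, hb0, hby⟩ := isSemisimpleElt_dual_iff.1 hy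
  exact isSemisimpleElt_doubleRep_iff.2 ⟨a, b, sub_mem ha hb, ha0, hb0, hax, hby⟩

theorem isSemisimpleElt_relPoint {u p : Fin n → K} (hp : support p = support u) :
    IsSemisimpleElt (doubleRep (torusRep K s)) (relPoint u p) := by
  classical
  let a : Fin n → ℤ := (support p).indicator 1
  have ha0 : 0 ≤ a := Set.indicator_nonneg fun _ _ => zero_le_one
  have hap : support a = support p := by simp [a, Set.support_indicator]
  refine isSemisimpleElt_doubleRep_iff.2 ⟨a, a, by simp, ha0, ha0, hap, hap.trans ?_⟩
  rw [relPoint, LinearEquiv.apply_symm_apply]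
  exact hp.trans ((support_div u p).trans (by rw [hp, Set.inter_self])).symm

variable [CharZero K]

theorem PositivelyDependent.isSemisimpleElt_fst_snd (hs : PositivelyDependent s)
    {z : (Fin n → K) × Module.Dual K (Fin n → K)} (hz : z ∈ nullFibre (torusLie K s))
    (hc : IsSemisimpleElt (doubleRep (torusRep K s)) z) :
    IsSemisimpleElt (torusRep K s) z.1 ∧ IsSemisimpleElt (torusRep K s).dual z.2 := by
  obtain ⟨a, b, hab, ha0, hb0, haz, hbz⟩ := isSemisimpleElt_doubleRep_iff.1 hc
  have hu := mem_nullFibre_iff.1 hz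
  have hsupp : support (z.1 * dualCoord K n z.2) = support a ∩ support b := by
    rw [support_mul', haz, hbz]
  have hba : b - a ∈ relations ℤ s := neg_sub a b ▸ neg_mem hab
  rw [isSemisimpleElt_torusRep_iff, isSemisimpleElt_dual_iff, ← haz, ← hbz]
  exact ⟨hs.exists_nonneg_support_eq hb0 ha0 hab hu hsupp,
    hs.exists_nonneg_support_eq ha0 hb0 hba hu (hsupp.trans (Set.inter_comm _ _))⟩

theorem isVisible_iff_closed_orbits (s : Fin n → Fin r → ℤ) :
    IsVisible (torusRep K s) ↔
      {O : Set ((Fin n → K) × Module.Dual K (Fin n → K)) |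
          ∃ z ∈ nullFibre (torusLie K s),
            O = repOrbit (doubleRep (torusRep K s)) z ∧ IsZariskiClosed K O} =
        {O : Set ((Fin n → K) × Module.Dual K (Fin n → K)) |
          ∃ x y, (x, y) ∈ nullFibre (torusLie K s) ∧
            O = repOrbit (doubleRep (torusRep K s)) (x, y) ∧
            IsSemisimpleElt (torusRep K s) x ∧ IsSemisimpleElt (torusRep K s).dual y} := by
  rw [(isDiagonal_torusRep s).isVisible_iff]
  constructor
  · intro hs
    ext O
    constructor
    · rintro ⟨z, hz, rfl, hc⟩
      exact ⟨z.1, z.2, hz, rfl, hs.isSemisimpleElt_fst_snd hz hc⟩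
    · rintro ⟨x, y, hz, rfl, hx, hy⟩
      exact ⟨_, hz, rfl, isSemisimpleElt_doubleRep_of hx hy⟩
  · intro h c hc hc_ne
    let u : Fin n → K := fun i => c i
    have hu : u ∈ relations K s := intCast_mem_relations_iff.2 hc
    obtain ⟨x, y, -, hO, hx, -⟩ := h.subset
      ⟨relPoint u u, relPoint_mem_nullFibre hu rfl, rfl, isSemisimpleElt_relPoint rfl⟩
    have hux : repOrbit (torusRep K s) u = repOrbit (torusRep K s) x := by
      rw [← repOrbit_doubleRep_fst _ (x, y), ← hO, repOrbit_doubleRep_fst, relPoint]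
    obtain ⟨a, ha, ha0, hau⟩ := isSemisimpleElt_torusRep_iff.1
      (show IsSemisimpleElt (torusRep K s) u by rwa [IsSemisimpleElt, hux])
    have hac : support a = support c := hau.trans (by ext i; simp [u])
    refine ⟨a, ha, ?_, ha0, hac.subset⟩
    rwa [← support_nonempty_iff, hac, support_nonempty_iff]

end NullFibre

section Quotient

open Function

theorem exists_isCompl_spanSubset {K ι : Type*} [Field K] [Finite ι] (R : Submodule K (ι → K)) :
    ∃ B : Set ι, IsCompl R (Pi.spanSubset K B) := by
  cases nonempty_fintype ι
  obtain ⟨B, -, -, hspan, hind⟩ := exists_linearIndepOn_extension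
    (linearIndepOn_empty K (R.mkQ ∘ Pi.basisFun K ι)) (Set.subset_univ _)
  refine ⟨B, disjoint_iff.2 ?_, codisjoint_iff.2 ?_⟩
  · have h := Submodule.range_ker_disjoint (f := R.mkQ) (v := fun i : B => Pi.basisFun K ι i) hind
    rwa [R.ker_mkQ, Set.range_comp', Subtype.range_coe, ← Pi.spanSubset, disjoint_comm,
      disjoint_iff] at h
  · rw [← R.map_mkQ_eq_top, Pi.spanSubset, Submodule.map_span, ← Set.image_comp, eq_top_iff,
      ← R.range_mkQ, LinearMap.range_eq_map, ← (Pi.basisFun K ι).span_eq, Submodule.map_span,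
      Submodule.span_le, ← Set.range_comp, ← Set.image_univ]
    exact hspan

theorem finrank_spanSubset_compl_eq {K ι : Type*} [Field K] [Finite ι] {R : Submodule K (ι → K)}
    {B : Set ι} (h : IsCompl R (Pi.spanSubset K B)) :
    Module.finrank K (Pi.spanSubset K Bᶜ) = Module.finrank K R := by
  cases nonempty_fintype ι
  have hR := Submodule.finrank_add_eq_of_isCompl h
  rw [Pi.dim_spanSubset, Module.finrank_fintype_fun_eq_card, ← Nat.card_eq_fintype_card,
    ← Set.ncard_add_ncard_compl B] at hR
  rw [Pi.dim_spanSubset]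
  omega

variable {K W : Type u} {ι κ : Type*} [Field K] [IsAlgClosed K] [AddCommGroup W] [Module K W]
  [Fintype ι] [Fintype κ] {w : ι → κ → ℤ} {ρ : Representation K (κ → Kˣ) W} {e : W ≃ₗ[K] (ι → K)}

namespace IsDiagonal

variable (h : IsDiagonal ρ e w)
include h

theorem exists_coord_eq_one {S : Set ι} (hS : relationsOn ℤ w S = ⊥) {x : W}
    (hx : S ⊆ support (e x)) : ∃ t, ∀ i ∈ S, e (ρ t x) i = 1 := by
  have hτ (i : ι) : ∃ τ : Kˣ, i ∈ S → (τ : K) * e x i = 1 := by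
    by_cases hi : i ∈ S
    · exact ⟨(Units.mk0 (e x i) (hx hi))⁻¹, fun _ => Units.inv_mul (Units.mk0 (e x i) (hx hi))⟩
    · exact ⟨1, fun h => absurd h hi⟩
  choose τ hτ using hτ
  obtain ⟨t, ht⟩ := exists_torusChar_eq (w := w) (τ := τ) (S := S) fun c hc => by
    rw [hS, Submodule.mem_bot] at hc
    simp [hc]
  exact ⟨t, fun i hi => by rw [h, ht i hi, hτ i hi]⟩

theorem eq_zero_of_slice {S T : Set ι} (hTS : T ⊆ S) (hT : relationsOn ℤ w T = ⊥)
    {f : polyFun K W} (hf : f ∈ invariantFun ρ)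
    (hfT : ∀ y, support (e y) ⊆ S \ T → f.1 (e.symm (T.indicator 1) + y) = 0) {x : W}
    (hx : support (e x) ⊆ S) : f.1 x = 0 := by
  classical
  set b : W := e.symm (T.indicator 1)
  have hb : e b = T.indicator 1 := e.apply_symm_apply _
  have hbT (i : ι) (hi : i ∈ T) : e b i = 1 := by rw [hb, Set.indicator_of_mem hi, Pi.one_apply]
  refine apply_eq_zero_of_line T.toFinset (fun i => LinearMap.proj i ∘ₗ e.toLinearMap) (b := b)
    (fun i hi => (hbT i (by simpa using hi)).trans_ne one_ne_zero) f.2 fun τ hτ => ?_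
  obtain ⟨t, ht⟩ := h.exists_coord_eq_one hT (x := x + τ • b) fun i hi => hτ i (by simpa using hi)
  have hsupp : support (e (ρ t (x + τ • b))) ⊆ S := by
    rw [h.support_coord_eq ⟨t, rfl⟩, map_add, map_smul, hb]
    exact (support_add _ _).trans (Set.union_subset hx ((support_const_smul_subset _ _).trans
      (Set.support_indicator_subset.trans hTS)))
  have hslice : support (e (ρ t (x + τ • b) - b)) ⊆ S \ T := by
    rw [map_sub]
    refine fun i hi => ⟨by_contra fun hiS => hi ?_, fun hiT => hi ?_⟩
    · rw [Pi.sub_apply, notMem_support.1 (mt (@hsupp i) hiS), hb,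
        Set.indicator_of_notMem (mt (@hTS i) hiS), sub_zero]
    · rw [Pi.sub_apply, ht i hiT, hbT i hiT, sub_self]
  have hft := hfT _ hslice
  rw [add_sub_cancel] at hft
  exact (congrFun (congrArg Subtype.val (hf t)) (x + τ • b)).symm.trans hft

theorem trdeg_invariantFun_le [CharZero K] : ∃ a ∈ relations ℤ w, 0 ≤ a ∧
    Algebra.trdeg K (invariantFun ρ) ≤ Module.finrank K (relationsOn K w (support a)) := by
  obtain ⟨a, ha, l, ha0, -, hla, hlx⟩ := exists_nonneg_relation_dotProduct_complementary w Set.univ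
  replace hlx (i : ι) (hi : i ∉ support a) : 0 < l ⬝ᵥ w i := hlx i ⟨trivial, hi⟩
  have hl (i : ι) : 0 ≤ l ⬝ᵥ w i := by
    by_cases hi : i ∈ support a
    exacts [(hla i hi).ge, (hlx i hi).le]
  refine ⟨a, ha, ha0, ?_⟩
  obtain ⟨B, hB⟩ := exists_isCompl_spanSubset (relationsOn K w (support a))
  let U : Submodule K W := (Pi.spanSubset K (support a \ B)).map e.symm.toLinearMap
  have hU : Module.finrank K U ≤ Module.finrank K (relationsOn K w (support a)) := by
    refine (LinearEquiv.finrank_map_eq e.symm _).trans_le ?_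
    rw [← finrank_spanSubset_compl_eq hB, Pi.dim_spanSubset, Pi.dim_spanSubset]
    exact Set.ncard_le_ncard Set.inter_subset_right
  have hBa : relationsOn ℤ w (support a ∩ B) = ⊥ := by
    refine (Submodule.eq_bot_iff _).2 fun c hc => funext fun i => ?_
    obtain ⟨hc, hcB⟩ := mem_relationsOn.1 hc
    have hcK : support (fun i => (c i : K)) ⊆ support a ∩ B := fun i hi => hcB (by simpa using hi)
    have h0 := Submodule.disjoint_def.1 hB.disjoint _
      (mem_relationsOn.2 ⟨intCast_mem_relations_iff.2 hc, hcK.trans Set.inter_subset_left⟩)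
      (mem_spanSubset_iff_support_subset.2 (hcK.trans Set.inter_subset_right))
    simpa using congrFun h0 i
  refine (trdeg_le_of_slice _ (isPolyMap_const_add (e.symm ((support a ∩ B).indicator 1))
    U.subtype) fun f hf hfU => ?_).trans (mod_cast hU)
  refine Subtype.ext (funext fun x => ?_)
  rw [← h.apply_limitPt_eq hf (l := l) fun i _ => hl i]
  refine h.eq_zero_of_slice Set.inter_subset_left hBa hf (fun y hy => hfU ⟨y, ?_⟩) ?_
  · rw [Set.sdiff_self_inter] at hy
    exact (Submodule.mem_map_equiv (e := e.symm) _).2 (mem_spanSubset_iff_support_subset.2 hy)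
  · rw [support_coord_limitPt]
    exact fun i hi => by_contra fun hia => (hlx i hia).ne' hi.1

end IsDiagonal

end Quotient

section Cartan

open Function

section Generic

theorem exists_mem_forall_support_subset {K ι : Type*} [Field K] [Infinite K] [Finite ι]
    (R : Submodule K (ι → K)) :
    ∃ ω ∈ R, ∀ u ∈ R, support u ⊆ support ω := by
  obtain ⟨ω, hω, hne⟩ := Module.Dual.exists_forall_mem_ne_zero_of_forall_exists R
    (fun i : {i // ∃ u ∈ R, u i ≠ 0} => (LinearMap.proj i.1 : (ι → K) →ₗ[K] K)) fun i => i.2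
  exact ⟨ω, hω, fun u hu i hi => hne ⟨i, u, hu, hi⟩⟩

theorem div_mem_of_mul_mem {K ι : Type*} [Field K] [Finite ι] {R : Submodule K (ι → K)} {q : ι → K}
    (hq : ∀ u ∈ R, q * u ∈ R) (hsupp : ∀ u ∈ R, support u ⊆ support q) {u : ι → K}
    (hu : u ∈ R) : u / q ∈ R := by
  have hinj : Injective ((LinearMap.mulLeft K q).restrict hq) := by
    refine (injective_iff_map_eq_zero _).2 fun x hx => Subtype.ext (funext fun i => ?_)
    by_contra hi
    exact mul_ne_zero (hsupp x x.2 hi) hi (congrFun (congrArg Subtype.val hx) i)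
  obtain ⟨x, hx⟩ := LinearMap.injective_iff_surjective.1 hinj ⟨u, hu⟩
  have hxu : u / q = x := funext fun i => by
    have hxi : q i * x.1 i = u i := congrFun (congrArg Subtype.val hx) i
    rw [Pi.div_apply, ← hxi]
    exact mul_div_cancel_left_of_imp fun hi => by_contra fun hxi => hsupp x x.2 hxi hi
  exact hxu ▸ x.2

variable {K ι κ : Type*} [Field K] [Fintype ι] {w : ι → κ → ℤ}

theorem exists_dotProduct_eq_single [DecidableEq ι] [Fintype κ] {S : Set ι} {i : ι} (hi : i ∈ S)
    (hS : ∀ u ∈ relationsOn K w S, u i = 0) :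
    ∃ h : κ → K, ∀ k ∈ S, (fun j => (w k j : K)) ⬝ᵥ h = (Pi.single i 1 : ι → K) k := by
  classical
  let φ : (ι → K) →ₗ[K] (κ → K) := Fintype.linearCombination K fun k j => (w k j : K)
  have hφ (k : ι) : φ (Pi.single k 1) = fun j => (w k j : K) := by
    rw [Fintype.linearCombination_apply_single, one_smul]
  have hnot : φ (Pi.single i 1) ∉ (Pi.spanSubset K (S \ {i})).map φ := by
    rintro ⟨u, hu, hui⟩
    replace hu := mem_spanSubset_iff_support_subset.1 hu
    have hu0 := hS (u - Pi.single i 1) (mem_relationsOn.2 ⟨?_, ?_⟩)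
    · rw [Pi.sub_apply, Pi.single_eq_same, notMem_support.1 fun hi => (hu hi).2 rfl] at hu0
      simp at hu0
    · exact LinearMap.sub_mem_ker_iff.2 hui
    · refine (support_sub _ _).trans (Set.union_subset (hu.trans Set.sdiff_subset) ?_)
      exact (Pi.support_single_subset).trans (Set.singleton_subset_iff.2 hi)
  obtain ⟨f, hf, hker⟩ := Submodule.exists_le_ker_of_notMem hnot
  refine ⟨(f (φ (Pi.single i 1)))⁻¹ • (dotProductEquiv K κ).symm f, fun k hk => ?_⟩
  have hfk : (fun j => (w k j : K)) ⬝ᵥ (dotProductEquiv K κ).symm f = f (φ (Pi.single k 1)) := by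
    rw [hφ, dotProduct_comm]
    exact LinearMap.congr_fun ((dotProductEquiv K κ).apply_symm_apply f) _
  rw [dotProduct_smul, hfk, smul_eq_mul]
  obtain rfl | hki := eq_or_ne k i
  · rw [Pi.single_eq_same, inv_mul_cancel₀ hf]
  · have hmem : Pi.single k 1 ∈ Pi.spanSubset K (S \ {i}) :=
      mem_spanSubset_iff_support_subset.2
        (Pi.support_single_subset.trans (Set.singleton_subset_iff.2 ⟨hk, hki⟩))
    rw [Pi.single_eq_of_ne hki, LinearMap.mem_ker.1 (hker ⟨_, hmem, rfl⟩), mul_zero]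

theorem positivelyDependent_of_sq_div_mem [CharZero K] {a : ι → ℤ} (ha : 0 ≤ a)
    (hsupp : ∀ c ∈ relations ℤ w, support c ⊆ support a)
    (hsq : ∀ c ∈ relations ℤ w, (fun i => (c i : K) ^ 2 / a i) ∈ relations K w) :
    PositivelyDependent w := by
  intro c hc hc_ne
  obtain ⟨N, hN, g, hg⟩ := exists_pos_int_mul fun i => (c i : ℚ) ^ 2 / a i
  have hN' : (0 : ℚ) < N := Int.cast_pos.2 hN
  refine ⟨g, (intCast_mem_relations_iff (R := K)).1 ?_, fun hg0 => ?_, fun i => ?_,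
    fun i hi hci => ?_⟩
  · have hgK : (fun i => (g i : K)) = (N : K) • fun i => (c i : K) ^ 2 / a i := funext fun i => by
      have h := congrArg (Rat.cast : ℚ → K) (hg i)
      push_cast at h
      exact h
    rw [hgK]
    exact Submodule.smul_mem _ _ (hsq c hc)
  · obtain ⟨i, hi⟩ := ne_iff.1 hc_ne
    have hgi := hg i
    rw [hg0, Pi.zero_apply, Int.cast_zero] at hgi
    have hai : a i ≠ 0 := hsupp c hc hi
    exact mul_ne_zero hN'.ne' (div_ne_zero (pow_ne_zero 2 (Int.cast_ne_zero.2 hi))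
      (Int.cast_ne_zero.2 hai)) hgi.symm
  · rw [Pi.zero_apply, ← Int.cast_nonneg_iff (R := ℚ), hg]
    have hai : (0 : ℚ) ≤ a i := Int.cast_nonneg_iff.2 (ha i)
    positivity
  · have hgi := hg i
    rw [hci] at hgi
    exact hi (by simpa using hgi)

end Generic

variable {K : Type u} [Field K] {r n : ℕ} {s : Fin n → Fin r → ℤ} {v : Fin n → K}

theorem mem_cartanOf_iff {x : Fin n → K} : x ∈ cartanOf (torusLie K s) v ↔
    ∀ h : Fin r → K, ∃ h' : Fin r → K, ∀ i,
      ((fun j => (s i j : K)) ⬝ᵥ h') * v i = ((fun j => (s i j : K)) ⬝ᵥ h) * x i := by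
  constructor
  · intro hx h
    obtain ⟨h', hh'⟩ := hx ⟨h, rfl⟩
    exact ⟨h', congrFun hh'⟩
  · rintro hx _ ⟨h, rfl⟩
    obtain ⟨h', hh'⟩ := hx h
    exact ⟨h', funext hh'⟩

theorem cartanOf_eq_of_weight_zero (v : Fin n → K) :
    ∃ v', (∀ i, s i = 0 → v' i ≠ 0) ∧ cartanOf (torusLie K s) v = cartanOf (torusLie K s) v' := by
  classical
  refine ⟨fun i => if s i = 0 then 1 else v i, fun i hi => by simp [hi], ?_⟩
  ext x
  simp only [mem_cartanOf_iff]
  refine forall_congr' fun h => exists_congr fun h' => forall_congr' fun i => ?_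
  by_cases hi : s i = 0 <;> simp [hi]

theorem div_mul_mem_relationsOn {x u : Fin n → K} (hx : x ∈ cartanOf (torusLie K s) v)
    (hu : u ∈ relationsOn K s (support v)) : u / v * x ∈ relationsOn K s (support v) := by
  obtain ⟨hu, huv⟩ := mem_relationsOn.1 hu
  refine mem_relationsOn.2 ⟨mem_relations.2 fun j => ?_, fun i hi hvi => hi (by simp [hvi])⟩
  obtain ⟨h', hh'⟩ := mem_cartanOf_iff.1 hx (Pi.single j 1)
  rw [← sum_mul_dotProduct_eq_zero hu h']
  refine Finset.sum_congr rfl fun i _ => ?_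
  have hi := hh' i
  rw [dotProduct_single_one] at hi
  by_cases hvi : v i = 0
  · have hui : u i = 0 := notMem_support.1 fun hui => huv hui hvi
    simp [hui]
  · simp only [Pi.mul_apply, Pi.div_apply]
    rw [mul_assoc, mul_comm (x i), ← hi, div_mul_eq_mul_div, mul_comm _ (v i), mul_left_comm,
      mul_div_cancel_left₀ _ hvi]

theorem single_mem_cartanOf {i : Fin n} (hi : v i ≠ 0)
    (hv : ∀ u ∈ relationsOn K s (support v), u i = 0) :
    Pi.single i 1 ∈ cartanOf (torusLie K s) v := by
  obtain ⟨h₀, hh₀⟩ := exists_dotProduct_eq_single hi hv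
  refine mem_cartanOf_iff.2 fun h => ⟨(((fun j => (s i j : K)) ⬝ᵥ h) / v i) • h₀, fun k => ?_⟩
  rw [dotProduct_smul, smul_eq_mul]
  by_cases hvk : v k = 0
  · have hki : k ≠ i := by rintro rfl; exact hi hvk
    rw [hvk, Pi.single_eq_of_ne hki, mul_zero, mul_zero]
  · rw [hh₀ k hvk]
    obtain rfl | hki := eq_or_ne k i
    · rw [Pi.single_eq_same, mul_one, mul_one, div_mul_cancel₀ _ hi]
    · rw [Pi.single_eq_of_ne hki, mul_zero, mul_zero, zero_mul]

/-- The map from `cartanOf v` to relations that sends `x` to `ω x / v`. -/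
def cartanToRel (s : Fin n → Fin r → ℤ) (v ω : Fin n → K) :
    cartanOf (torusLie K s) v →ₗ[K] (Fin n → K) :=
  LinearMap.mulLeft K (ω / v) ∘ₗ (cartanOf (torusLie K s) v).subtype

variable {ω : Fin n → K}

theorem cartanToRel_apply (x : cartanOf (torusLie K s) v) :
    cartanToRel s v ω x = ω / v * x.1 := rfl

theorem range_cartanToRel_le (hω : ω ∈ relationsOn K s (support v)) :
    LinearMap.range (cartanToRel s v ω) ≤ relationsOn K s (support v) := by
  rintro _ ⟨x, rfl⟩
  exact div_mul_mem_relationsOn x.2 hω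

variable [CharZero K]

theorem support_subset_of_mem_cartanOf (hv : ∀ i, s i = 0 → v i ≠ 0) {x : Fin n → K}
    (hx : x ∈ cartanOf (torusLie K s) v) : support x ⊆ support v := by
  intro i hi hvi
  obtain ⟨j, hj⟩ := ne_iff.1 fun hsi => hv i hsi hvi
  obtain ⟨h', hh'⟩ := mem_cartanOf_iff.1 hx (Pi.single j 1)
  have hij := hh' i
  rw [hvi, mul_zero, dotProduct_single_one] at hij
  exact (mul_ne_zero (Int.cast_ne_zero.2 hj) hi) hij.symm

variable [IsAlgClosed K]
  (hd : (Module.finrank K (cartanOf (torusLie K s) v) : Cardinal) ≤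
    Algebra.trdeg K (invariantFun (torusRep K s)))

include hd

theorem finrank_cartanOf_le_relationsOn : ∃ a ∈ relations ℤ s, 0 ≤ a ∧
    Module.finrank K (cartanOf (torusLie K s) v) ≤
      Module.finrank K (relationsOn K s (support a)) := by
  obtain ⟨a, ha, ha0, hle⟩ := (isDiagonal_torusRep (K := K) s).trdeg_invariantFun_le
  exact ⟨a, ha, ha0, mod_cast hd.trans hle⟩

theorem finrank_cartanOf_le :
    Module.finrank K (cartanOf (torusLie K s) v) ≤ Module.finrank K (relations K s) := by
  obtain ⟨a, -, -, hle⟩ := finrank_cartanOf_le_relationsOn hd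
  exact hle.trans (Submodule.finrank_mono inf_le_left)

theorem exists_nonneg_relation_support_maximal
    (hsurj : relations K s ≤ LinearMap.range (cartanToRel s v ω)) :
    ∃ a ∈ relations ℤ s, 0 ≤ a ∧ ∀ u ∈ relations K s, support u ⊆ support a := by
  obtain ⟨a, ha, ha0, hle⟩ := finrank_cartanOf_le_relationsOn hd
  have hall : relationsOn K s (support a) = relations K s :=
    Submodule.eq_of_le_of_finrank_le inf_le_left
      ((Submodule.finrank_mono hsurj).trans ((LinearMap.finrank_range_le _).trans hle))
  exact ⟨a, ha, ha0, fun u hu => (mem_relationsOn.1 (hall ▸ hu)).2⟩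

theorem positivelyDependent_of_surjective
    (hsurj : relations K s ≤ LinearMap.range (cartanToRel s v ω)) : PositivelyDependent s := by
  obtain ⟨a, ha, ha0, hmax⟩ := exists_nonneg_relation_support_maximal hd hsurj
  have hsupp (u : Fin n → K) (hu : u ∈ relations K s) : u ∈ relationsOn K s (support v) := by
    obtain ⟨x, rfl⟩ := hsurj hu
    exact mem_relationsOn.2 ⟨hu, fun i hi hvi => hi (by simp [cartanToRel_apply, hvi])⟩
  have hmul (x : cartanOf (torusLie K s) v) (u : Fin n → K) (hu : u ∈ relations K s) :
      x.1 / v * u ∈ relations K s := by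
    rw [div_mul_comm]
    exact (mem_relationsOn.1 (div_mul_mem_relationsOn x.2 (hsupp u hu))).1
  obtain ⟨x, hx⟩ := hsurj (intCast_mem_relations_iff.2 ha)
  have hax (i : Fin n) : ω i / v i * x.1 i = a i := congrFun hx i
  have hxa (u : Fin n → K) (hu : u ∈ relations K s) : support u ⊆ support (x.1 / v) :=
    (hmax u hu).trans fun i hi hxi => hi (by
      have hai := hax i
      rw [div_mul_comm, ← Pi.div_apply, hxi, zero_mul] at hai
      exact_mod_cast hai.symm)
  refine positivelyDependent_of_sq_div_mem (K := K) ha0 (fun c hc i hi => ?_) fun c hc => ?_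
  · exact hmax _ (intCast_mem_relations_iff.2 hc) (Int.cast_ne_zero.2 hi)
  · have hcK := (intCast_mem_relations_iff (R := K)).2 hc
    obtain ⟨y, hy⟩ := hsurj hcK
    convert hmul y _ (div_mem_of_mul_mem (hmul x) hxa hcK) using 1
    funext i
    have hcy : ω i / v i * y.1 i = c i := congrFun hy i
    simp only [Pi.mul_apply, Pi.div_apply]
    by_cases hωv : ω i / v i = 0
    · rw [← hcy, hωv]
      simp
    · have hvi : v i ≠ 0 := fun hvi => hωv (by rw [hvi, div_zero])
      calc (c i : K) ^ 2 / a i = c i * ((ω i / v i * y.1 i) / (ω i / v i * x.1 i)) := by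
            rw [hcy, hax, sq, mul_div_assoc]
        _ = c i * (y.1 i / x.1 i) := by rw [mul_div_mul_left _ _ hωv]
        _ = y.1 i / v i * (c i / (x.1 i / v i)) := by field_simp

theorem finrank_range_cartanToRel_lt (hω : ω ∈ relationsOn K s (support v))
    (hs : ¬ PositivelyDependent s) :
    Module.finrank K (LinearMap.range (cartanToRel s v ω)) < Module.finrank K (relations K s) := by
  have hle : LinearMap.range (cartanToRel s v ω) ≤ relations K s :=
    (range_cartanToRel_le hω).trans inf_le_left
  refine lt_of_le_of_ne (Submodule.finrank_mono hle) fun h => hs ?_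
  exact positivelyDependent_of_surjective hd (Submodule.eq_of_le_of_finrank_eq hle h).ge

end Cartan

section Closure

open Function

theorem fst_mem_zariskiClosure_repOrbit {K G V : Type*} [Field K] [Group G] [AddCommGroup V]
    [Module K V] {ρ : Representation K G V} {z z' : V × Module.Dual K V}
    (hz : z ∈ zariskiClosure K (repOrbit (doubleRep ρ) z')) :
    z.1 ∈ zariskiClosure K (repOrbit ρ z'.1) := by
  refine fun f hf => hz (polyFunComap (LinearMap.fst K V (Module.Dual K V)) f) ?_
  rintro _ ⟨g, rfl⟩
  exact hf _ ⟨g, rfl⟩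

variable {K : Type u} [Field K] [IsAlgClosed K] {r n : ℕ} {s : Fin n → Fin r → ℤ}
  {v ω : Fin n → K}

theorem card_le_finrank_range_cartanToRel {κ : Type*} [Fintype κ] {c : κ → Fin n → ℤ}
    (hωv : support ω ⊆ support v) (hind : LinearIndependent ℤ c)
    (hc : ∀ k, c k ∈ relationsOn ℤ s (support ω))
    (h : ∀ p : Fin n → K, support p = support ω →
      ∃ x ∈ cartanOf (torusLie K s) v, p ∈ zariskiClosure K (repOrbit (torusRep K s) x)) :
    Fintype.card κ ≤ Module.finrank K (LinearMap.range (cartanToRel s v ω)) := by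
  refine card_le_finrank_of_prod_zpow_surjective (fun i => (v i / ω i) •
    (LinearMap.proj i ∘ₗ (LinearMap.range (cartanToRel s v ω)).subtype)) c fun b => ?_
  obtain ⟨p, hp, hpb⟩ :=
    exists_support_eq_prod_zpow_eq hind (fun k => (mem_relationsOn.1 (hc k)).2) b
  obtain ⟨x, hx, hpx⟩ := h p hp
  refine ⟨⟨_, LinearMap.mem_range_self _ ⟨x, hx⟩⟩, fun k => ?_⟩
  obtain ⟨hck, hckω⟩ := mem_relationsOn.1 (hc k)
  have hprod : ∏ i, p i ^ c k i = ∏ i, x i ^ c k i :=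
    (isDiagonal_torusRep s).prod_zpow_eq_of_mem_closure hpx hck (hckω.trans hp.ge)
  rw [← hpb k, hprod]
  refine Finset.prod_congr rfl fun i _ => ?_
  by_cases hi : c k i = 0
  · rw [hi, zpow_zero, zpow_zero]
  · have hωi : ω i ≠ 0 := hckω hi
    have hvi : v i ≠ 0 := hωv hωi
    congr 1
    change v i / ω i * (ω i / v i * x i) = x i
    field_simp

variable [CharZero K]

theorem exists_closed_orbit_not_mem_closure (hv : ∀ i, s i = 0 → v i ≠ 0)
    (hd : (Module.finrank K (cartanOf (torusLie K s) v) : Cardinal) ≤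
      Algebra.trdeg K (invariantFun (torusRep K s)))
    (hs : ¬ PositivelyDependent s) (Y : Set (Module.Dual K (Fin n → K))) :
    ∃ z ∈ nullFibre (torusLie K s), IsSemisimpleElt (doubleRep (torusRep K s)) z ∧
      ∀ x ∈ cartanOf (torusLie K s) v, ∀ y ∈ Y,
        z ∉ zariskiClosure K (repOrbit (doubleRep (torusRep K s)) (x, y)) := by
  have : Infinite K := CharZero.infinite K
  by_contra! hcon
  have hmeet {u p : Fin n → K} (hu : u ∈ relations K s) (hp : support p = support u) :
      ∃ x ∈ cartanOf (torusLie K s) v, p ∈ zariskiClosure K (repOrbit (torusRep K s) x) := by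
    obtain ⟨x, hx, y, -, hxy⟩ :=
      hcon (relPoint u p) (relPoint_mem_nullFibre hu hp) (isSemisimpleElt_relPoint hp)
    exact ⟨x, hx, fst_mem_zariskiClosure_repOrbit hxy⟩
  have hsupp (u : Fin n → K) (hu : u ∈ relations K s) : support u ⊆ support v := by
    obtain ⟨x, hx, hux⟩ := hmeet hu rfl
    exact ((isDiagonal_torusRep s).support_coord_subset hux).trans
      (support_subset_of_mem_cartanOf hv hx)
  obtain ⟨ω, hω, hmax⟩ := exists_mem_forall_support_subset (relations K s)
  obtain ⟨c, hc, hind⟩ := exists_int_basis_relationsOn (K := K) s (support ω)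
  have hcard := card_le_finrank_range_cartanToRel (hsupp ω hω) hind hc fun p hp => hmeet hω hp
  have hall : relationsOn K s (support ω) = relations K s :=
    inf_eq_left.2 fun u hu => mem_spanSubset_iff_support_subset.2 (hmax u hu)
  rw [Fintype.card_fin, hall] at hcard
  exact hcard.not_gt (finrank_range_cartanToRel_lt hd (mem_relationsOn.2 ⟨hω, hsupp ω hω⟩) hs)

end Closure

section Reduction

open Function

section General

variable {K G V 𝔤 : Type*} [Field K] [Group G] [AddCommGroup V] [Module K V] [AddCommGroup 𝔤]
  [Module K 𝔤]

theorem momentIdeal_le_ker_evalAt {dρ : 𝔤 →ₗ[K] Module.End K V} {z : V × Module.Dual K V}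
    (hz : z ∈ nullFibre dρ) : momentIdeal dρ ≤ RingHom.ker (evalAt z) := by
  refine Ideal.span_le.2 ?_
  rintro f ⟨h, hf⟩
  exact (hf z).trans (LinearMap.congr_fun hz h)

/-- Evaluation of functions on the symplectic reduction at a point of the null fibre. -/
def evalReduction (ρ : Representation K G V) {dρ : 𝔤 →ₗ[K] Module.End K V}
    {z : V × Module.Dual K V} (hz : z ∈ nullFibre dρ) : symplecticReductionRing ρ dρ →ₐ[K] K :=
  (Ideal.Quotient.liftₐ (momentIdeal dρ) (evalAt z) (momentIdeal_le_ker_evalAt hz)).comp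
    (symplecticReductionRing ρ dρ).val

/-- The restriction of invariant functions on `V ⊕ V*` to the null fibre. -/
def reductionOf (ρ : Representation K G V) (dρ : 𝔤 →ₗ[K] Module.End K V) :
    invariantFun (doubleRep ρ) →ₐ[K] symplecticReductionRing ρ dρ :=
  ((Ideal.Quotient.mkₐ K (momentIdeal dρ)).comp (invariantFun (doubleRep ρ)).val).codRestrict _
    fun f => ⟨f.1, fun g => by simp [f.2 g], rfl⟩

end General

theorem IsDiagonal.monomialFun_mem_invariantFun {K W ι κ : Type*} [Field K] [AddCommGroup W]
    [Module K W] [Fintype ι] [Fintype κ] {w : ι → κ → ℤ} {ρ : Representation K (κ → Kˣ) W}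
    {e : W ≃ₗ[K] (ι → K)} (h : IsDiagonal ρ e w) {m : ι → ℕ}
    (hm : (fun i => (m i : ℤ)) ∈ relations ℤ w) : monomialFun e m ∈ invariantFun ρ := by
  refine fun t => Subtype.ext (funext fun x => (h.monomialFun_apply m t x).trans ?_)
  have hprod := congrArg Units.val (prod_torusChar_zpow_eq_one hm t)
  simp only [zpow_natCast, Units.coe_prod, Units.val_pow_eq_pow_val, Units.val_one] at hprod
  rw [hprod, one_mul]

variable {K : Type u} [Field K] {r n : ℕ} {s : Fin n → Fin r → ℤ}

theorem isPolyMap_mul_dualCoord : IsPolyMap K fun z : (Fin n → K) × Module.Dual K (Fin n → K) =>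
    z.1 * dualCoord K n z.2 :=
  isPolyMap_of_coord (LinearEquiv.refl K _) fun i => (polyFun K _).mul_mem
    (dual_mem_polyFun (LinearMap.proj i ∘ₗ LinearMap.fst K (Fin n → K) (Module.Dual K (Fin n → K))))
    (dual_mem_polyFun (LinearMap.proj i ∘ₗ (dualCoord K n).toLinearMap ∘ₗ
      LinearMap.snd K (Fin n → K) (Module.Dual K (Fin n → K))))

/-- The invariant function `(x, y) ↦ L (x y)` on `V ⊕ V*`, where `x y` is the coordinatewise
product. -/
def pairingFun (s : Fin n → Fin r → ℤ) (L : Module.Dual K (Fin n → K)) :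
    invariantFun (doubleRep (torusRep K s)) where
  val := isPolyMap_mul_dualCoord.comap ⟨L, dual_mem_polyFun L⟩
  property t := Subtype.ext <| funext fun z => congrArg L <| funext fun i => by
    have hx := isDiagonal_torusRep s t z.1 i
    have hy := isDiagonal_dual s t z.2 i
    rw [Pi.neg_apply, torusChar_neg] at hy
    refine (congrArg₂ (· * ·) hx hy).trans ?_
    rw [mul_mul_mul_comm, Units.mul_inv, one_mul]
    rfl

/-- The invariant monomial `x ^ c⁺ y ^ c⁻` on `V ⊕ V*` attached to an integral relation `c`. On the
null fibre it is the product of the character `x ^ c` and a monomial in `x y`. -/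
def characterFun {c : Fin n → ℤ} (hc : c ∈ relations ℤ s) :
    invariantFun (doubleRep (torusRep K s)) where
  val := monomialFun (prodCoord K n) (Sum.elim (fun i => (c i).toNat) fun i => (-c i).toNat)
  property := (isDiagonal_doubleRep s).monomialFun_mem_invariantFun <| by
    have hc' : (fun i => ((c i).toNat : ℤ)) - (fun i => ((-c i).toNat : ℤ)) = c :=
      funext fun i => Int.toNat_sub_toNat_neg (c i)
    convert sumElim_mem_relations_iff.2 (hc'.symm ▸ hc) using 1
    ext (i | i) <;> rfl

theorem pairingFun_relPoint (L : Module.Dual K (Fin n → K)) {u p : Fin n → K}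
    (hp : support p = support u) : (pairingFun s L).1.1 (relPoint u p) = L u := by
  refine congrArg L (funext fun i => ?_)
  change p i * dualCoord K n ((dualCoord K n).symm (u / p)) i = u i
  rw [LinearEquiv.apply_symm_apply]
  refine mul_div_cancel_of_imp' fun hi => ?_
  rwa [← notMem_support, ← hp, notMem_support]

theorem characterFun_relPoint {c : Fin n → ℤ} (hc : c ∈ relations ℤ s) {u p : Fin n → K}
    (hcp : support c ⊆ support p) : (characterFun hc).1.1 (relPoint u p) =
      (∏ i, p i ^ c i) * ∏ i, u i ^ (-c i).toNat := by
  have hprod := prod_zpow_mul_prod_pow hcp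
  refine (monomialFun_apply _ _ _).trans ?_
  simp only [prodCoord_apply, relPoint, LinearEquiv.apply_symm_apply, Fintype.prod_sum_type,
    Sum.elim_inl, Sum.elim_inr, Pi.div_apply, div_pow, Finset.prod_div_distrib]
  rw [← hprod, mul_assoc, mul_div_cancel₀ _ (prod_pow_toNat_neg_ne_zero hcp)]

variable [IsAlgClosed K]

theorem exists_characterFun_relPoint_eq {κ : Type*} [Finite κ] {c : κ → Fin n → ℤ}
    (hc : ∀ k, c k ∈ relations ℤ s) (hind : LinearIndependent ℤ c) {u : Fin n → K}
    (hcu : ∀ k, support (c k) ⊆ support u) {b : κ → K} (hb : ∀ k, b k ≠ 0) :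
    ∃ p, support p = support u ∧ ∀ k, (characterFun (hc k)).1.1 (relPoint u p) = b k := by
  have hu (k : κ) : ∏ i, u i ^ (-c k i).toNat ≠ 0 := prod_pow_toNat_neg_ne_zero (hcu k)
  obtain ⟨p, hp, hpb⟩ := exists_support_eq_prod_zpow_eq hind hcu fun k =>
    Units.mk0 (b k) (hb k) / Units.mk0 _ (hu k)
  refine ⟨p, hp, fun k => ?_⟩
  rw [characterFun_relPoint (hc k) ((hcu k).trans hp.ge), hpb k, Units.val_div_eq_div_val,
    Units.val_mk0, Units.val_mk0, div_mul_cancel₀ _ (hu k)]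

variable [CharZero K]

-- Stated for an isomorphic copy `A` of the reduction ring, because finding the ring structure of
-- that subalgebra of a quotient of a subalgebra is prohibitively slow.
theorem algebraicIndependent_reductionOf {ι κ A : Type*} [Finite ι] [Finite κ] [CommRing A]
    [Algebra K A] (E : symplecticReductionRing (torusRep K s) (torusLie K s) ≃ₐ[K] A)
    (b : Module.Basis ι K (relations K s)) {L : ι → Module.Dual K (Fin n → K)}
    (hL : ∀ k u, L k u.1 = b.equivFun u k) {c : κ → Fin n → ℤ} (hc : ∀ k, c k ∈ relations ℤ s)
    (hind : LinearIndependent ℤ c) : AlgebraicIndependent K fun o => E (reductionOf _ _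
      (Sum.elim (fun k => pairingFun s (L k)) (fun k => characterFun (hc k)) o)) := by
  classical
  have : Infinite K := CharZero.infinite K
  obtain ⟨ω, hω, hmax⟩ := exists_mem_forall_support_subset (relations K s)
  let U : (ι ⊕ κ → K) →ₗ[K] relations K s :=
    b.equivFun.symm.toLinearMap ∘ₗ LinearMap.funLeft K K Sum.inl
  let l : support ω ⊕ κ → Module.Dual K (ι ⊕ κ → K) := Sum.elim
    (fun i => LinearMap.proj i.1 ∘ₗ (relations K s).subtype ∘ₗ U)
    fun k => LinearMap.proj (Sum.inr k)
  have hl : ∀ j, l j ≠ 0 := by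
    rintro (i | k) h
    · have hU : U (Sum.elim (b.equivFun ⟨ω, hω⟩) 0) = ⟨ω, hω⟩ := b.equivFun.symm_apply_apply _
      exact i.2 ((congrFun (congrArg Subtype.val hU) i).symm.trans (LinearMap.congr_fun h _))
    · have hk : (Pi.single (Sum.inr k) 1 : ι ⊕ κ → K) (Sum.inr k) = 0 :=
        LinearMap.congr_fun h (Pi.single (Sum.inr k) 1)
      exact one_ne_zero ((Pi.single_eq_same _ _).symm.trans hk)
  refine algebraicIndependent_of_eval hl fun a ha => ?_
  have hUa : support (U a).1 = support ω :=
    (hmax _ (U a).2).antisymm fun i hi => ha (Sum.inl ⟨i, hi⟩)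
  obtain ⟨p, hp, hpa⟩ := exists_characterFun_relPoint_eq hc hind
    (fun k i hi => hUa.ge (hmax _ (intCast_mem_relations_iff.2 (hc k)) (Int.cast_ne_zero.2 hi)))
    fun k => ha (Sum.inr k)
  let ε := evalReduction (torusRep K s) (relPoint_mem_nullFibre (U a).2 hp)
  refine ⟨ε.comp E.symm.toAlgHom, fun o => (congrArg ε (E.symm_apply_apply _)).trans ?_⟩
  rcases o with k | k
  · refine (pairingFun_relPoint (s := s) (L k) hp).trans ((hL k (U a)).trans ?_)
    exact congrFun (b.equivFun.apply_symm_apply _) k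
  · exact hpa k

theorem two_mul_finrank_relations_le_trdeg {A : Type u} [CommRing A] [Algebra K A]
    (E : symplecticReductionRing (torusRep K s) (torusLie K s) ≃ₐ[K] A) :
    ((2 * Module.finrank K (relations K s) : ℕ) : Cardinal) ≤ Algebra.trdeg K A := by
  have hint := exists_int_basis_relationsOn (K := K) s Set.univ
  rw [relationsOn_univ] at hint
  obtain ⟨c, hc, hind⟩ := hint
  let b := Module.finBasis K (relations K s)
  obtain ⟨φ, hφ⟩ := LinearMap.exists_extend b.equivFun.toLinearMap
  have halg := algebraicIndependent_reductionOf E b (L := fun k => LinearMap.proj k ∘ₗ φ)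
    (fun k u => congrFun (LinearMap.congr_fun hφ u) k) (fun k => (mem_relationsOn.1 (hc k)).1) hind
  rw [two_mul]
  simpa using halg.lift_cardinalMk_le_trdeg

end Reduction

section Weyl

open Function

theorem exists_mem_weylGroup {K G V : Type*} [Field K] [Group G] [AddCommGroup V] [Module K V]
    {ρ : Representation K G V} {c : Submodule K V} [FiniteDimensional K c] {g : G}
    (h : ∀ x ∈ c, ρ g x ∈ c) : ∃ w ∈ weylGroup ρ c, ∀ x : c, (w x : V) = ρ g x :=
  ⟨LinearEquiv.ofInjectiveEndo ((ρ g).restrict h) fun _ _ hxy =>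
    Subtype.ext (ρ.apply_bijective g |>.1 (congrArg Subtype.val hxy)),
    ⟨g, fun _ => rfl⟩, fun _ => rfl⟩

variable {K : Type u} [Field K] {r n : ℕ} {s : Fin n → Fin r → ℤ} {v ω : Fin n → K}

theorem mem_cartanOf_of_support_subset
    (hmax : ∀ u ∈ relationsOn K s (support v), support u ⊆ support ω) {x : Fin n → K}
    (hx : support x ⊆ support v \ support ω) : x ∈ cartanOf (torusLie K s) v := by
  classical
  rw [pi_eq_sum_univ' x]
  refine Submodule.sum_mem _ fun i _ => ?_
  by_cases hi : x i = 0
  · rw [hi, zero_smul]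
    exact zero_mem _
  · refine Submodule.smul_mem _ _ (single_mem_cartanOf (hx hi).1 fun u hu => ?_)
    exact notMem_support.1 fun hui => (hx hi).2 (hmax u hu hui)

theorem finrank_comap_spanSubset_le (hωv : support ω ⊆ support v) :
    Module.finrank K ((Pi.spanSubset K (support ω)).comap (cartanOf (torusLie K s) v).subtype) ≤
      Module.finrank K (LinearMap.range (cartanToRel s v ω)) := by
  refine LinearMap.finrank_le_finrank_of_injective
    (f := (cartanToRel s v ω).rangeRestrict ∘ₗ Submodule.subtype _)
    ((injective_iff_map_eq_zero _).2 fun x hx => Subtype.ext (Subtype.ext (funext fun i => ?_)))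
  by_contra hi
  have hωi : ω i ≠ 0 := mem_spanSubset_iff_support_subset.1 x.2 hi
  have hxi : ω i / v i * x.1.1 i = 0 := congrFun (congrArg Subtype.val hx) i
  exact mul_ne_zero (div_ne_zero hωi (hωv hωi)) hi hxi

variable [CharZero K]

theorem torusRep_mem_cartanOf (hv : ∀ i, s i = 0 → v i ≠ 0)
    (hmax : ∀ u ∈ relationsOn K s (support v), support u ⊆ support ω) {t : Fin r → Kˣ}
    (ht : ∀ i ∈ support ω, torusChar t (s i) = 1) {x : Fin n → K}
    (hx : x ∈ cartanOf (torusLie K s) v) : torusRep K s t x ∈ cartanOf (torusLie K s) v := by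
  have hcoord (i : Fin n) :
      (torusRep K s t x - x) i = ((torusChar t (s i) : Kˣ) - 1 : K) * x i := by
    rw [sub_one_mul]
    rfl
  have hdiff : torusRep K s t x - x ∈ cartanOf (torusLie K s) v := by
    refine mem_cartanOf_of_support_subset hmax fun i hi => ?_
    rw [mem_support, hcoord] at hi
    refine ⟨support_subset_of_mem_cartanOf hv hx (right_ne_zero_of_mul hi), fun hωi => hi ?_⟩
    rw [ht i hωi, Units.val_one, sub_self, zero_mul]
  simpa using add_mem hdiff hx

variable [IsAlgClosed K]

theorem exists_weylGroup_slice (hv : ∀ i, s i = 0 → v i ≠ 0) (hωv : support ω ⊆ support v)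
    (hmax : ∀ u ∈ relationsOn K s (support v), support u ⊆ support ω)
    (x : cartanOf (torusLie K s) v) (hx : support v \ support ω ⊆ support x.1) :
    ∃ w ∈ weylGroup (torusRep K s) (cartanOf (torusLie K s) v),
      support ((w x).1 - (support v \ support ω).indicator 1) ⊆ support ω := by
  classical
  let τ (i : Fin n) : Kˣ :=
    if h : i ∈ support v \ support ω then (Units.mk0 (x.1 i) (hx h))⁻¹ else 1
  have hτ (i : Fin n) (hi : i ∈ support ω) : τ i = 1 := dif_neg fun h => h.2 hi
  obtain ⟨t, ht⟩ := exists_torusChar_eq (w := s) (τ := τ) (S := support v) fun c hc => by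
    refine Finset.prod_eq_one fun i _ => ?_
    by_cases hi : i ∈ support ω
    · rw [hτ i hi, one_zpow]
    · have hci : c i = 0 := by_contra fun h =>
        hi (hmax _ (intCast_mem_relationsOn hc) (Int.cast_ne_zero.2 h))
      rw [hci, zpow_zero]
  obtain ⟨w, hw, hwx⟩ := exists_mem_weylGroup (ρ := torusRep K s) (g := t) fun y hy =>
    torusRep_mem_cartanOf hv hmax (fun i hi => (ht i (hωv hi)).trans (hτ i hi)) hy
  refine ⟨w, hw, fun i hi => by_contra fun hωi => hi ?_⟩
  have hti : torusRep K s t x.1 i = torusChar t (s i) * x.1 i := rfl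
  rw [Pi.sub_apply, hwx, hti]
  by_cases hvi : i ∈ support v
  · have hmem : i ∈ support v \ support ω := ⟨hvi, hωi⟩
    rw [ht i hvi, Set.indicator_of_mem hmem, Pi.one_apply, sub_eq_zero]
    simp only [τ, dif_pos hmem, Units.val_inv_eq_inv_val]
    exact inv_mul_cancel₀ (hx hmem)
  · have hxi : x.1 i = 0 := notMem_support.1 fun h => hvi (support_subset_of_mem_cartanOf hv x.2 h)
    rw [Set.indicator_of_notMem fun h => hvi h.1, hxi, mul_zero, sub_zero]

theorem trdeg_weylInvariantRing_le (hv : ∀ i, s i = 0 → v i ≠ 0) (hωv : support ω ⊆ support v)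
    (hmax : ∀ u ∈ relationsOn K s (support v), support u ⊆ support ω) :
    Algebra.trdeg K (weylInvariantRing (torusRep K s) (cartanOf (torusLie K s) v)) ≤
      ((Module.finrank K (LinearMap.range (cartanToRel s v ω)) +
        Module.finrank K (cartanOf (torusLie K s) v) : ℕ) : Cardinal) := by
  classical
  have : Infinite K := CharZero.infinite K
  set c := cartanOf (torusLie K s) v
  let c₁ : Submodule K c := (Pi.spanSubset K (support ω)).comap c.subtype
  let x₀ : c := ⟨(support v \ support ω).indicator 1,
    mem_cartanOf_of_support_subset hmax Set.support_indicator_subset⟩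
  -- Restriction to the slice of all `(x, ψ)` with `x = 1` on `support v \ support ω`.
  refine (trdeg_le_of_slice _ (isPolyMap_const_add (W₀ := c₁ × Module.Dual K c)
    ((x₀, 0) : c × Module.Dual K c) (c₁.subtype.prodMap LinearMap.id)) ?_).trans ?_
  · intro f hf hfU
    have hopen (x : c) (ψ : Module.Dual K c) (hx : support v \ support ω ⊆ support x.1) :
        f.1 (x, ψ) = 0 := by
      obtain ⟨w, hw, hwx⟩ := exists_weylGroup_slice hv hωv hmax x hx
      have hmem : w x - x₀ ∈ c₁ := mem_spanSubset_iff_support_subset.2 hwx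
      calc f.1 (x, ψ) = f.1 (w x, ψ ∘ₗ w.symm.toLinearMap) :=
            (congrFun (congrArg Subtype.val (hf w hw)) (x, ψ)).symm
        _ = f.1 ((x₀, 0) + (w x - x₀, ψ ∘ₗ w.symm.toLinearMap)) := by
            rw [Prod.mk_add_mk, add_sub_cancel, zero_add]
        _ = 0 := hfU (⟨_, hmem⟩, ψ ∘ₗ w.symm.toLinearMap)
    refine Subtype.ext (funext fun ⟨x, ψ⟩ => ?_)
    refine apply_eq_zero_of_line (support v \ support ω).toFinset
      (fun i => LinearMap.proj i ∘ₗ c.subtype ∘ₗ LinearMap.fst K c (Module.Dual K c))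
      (x := (x, ψ)) (b := (x₀, 0)) (fun i hi => ?_) f.2 fun τ hτ => ?_
    · have hx₀ : x₀.1 i = 1 := Set.indicator_of_mem (Set.mem_toFinset.1 hi) 1
      exact hx₀.trans_ne one_ne_zero
    · exact hopen _ _ fun i hi => hτ i (Set.mem_toFinset.2 hi)
  · have : Module.Free K c₁ := Module.Free.of_divisionRing K c₁
    rw [Module.finrank_prod, Subspace.dual_finrank_eq]
    exact mod_cast Nat.add_le_add_right (finrank_comap_spanSubset_le hωv) _

theorem isEmpty_symplecticReductionRing_equiv (hv : ∀ i, s i = 0 → v i ≠ 0)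
    (hd : (Module.finrank K (cartanOf (torusLie K s) v) : Cardinal) ≤
      Algebra.trdeg K (invariantFun (torusRep K s))) (hs : ¬ PositivelyDependent s) :
    IsEmpty (symplecticReductionRing (torusRep K s) (torusLie K s) ≃ₐ[K]
      weylInvariantRing (torusRep K s) (cartanOf (torusLie K s) v)) := by
  refine ⟨fun E => ?_⟩
  have : Infinite K := CharZero.infinite K
  obtain ⟨ω, hω, hmax⟩ := exists_mem_forall_support_subset (relationsOn K s (support v))
  have htrdeg := (two_mul_finrank_relations_le_trdeg
    (A := weylInvariantRing (torusRep K s) (cartanOf (torusLie K s) v)) E).trans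
    (trdeg_weylInvariantRing_le hv (mem_relationsOn.1 hω).2 hmax)
  have hrank := finrank_range_cartanToRel_lt hd hω hs
  have hcartan := finrank_cartanOf_le hd
  have hle := Nat.cast_le.1 htrdeg
  omega

end Weyl

end MomentTorus

end

theorem mainTheorem5 {K : Type*} [Field K] [IsAlgClosed K] [CharZero K] {r n : ℕ}
    (s : Fin n → Fin r → ℤ) :
    (MomentTorus.IsVisible (MomentTorus.torusRep K s) ↔
      {O : Set ((Fin n → K) × Module.Dual K (Fin n → K)) |
          ∃ z ∈ MomentTorus.nullFibre (MomentTorus.torusLie K s),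
            O = MomentTorus.repOrbit (MomentTorus.doubleRep (MomentTorus.torusRep K s)) z ∧
            MomentTorus.IsZariskiClosed K O} =
        {O : Set ((Fin n → K) × Module.Dual K (Fin n → K)) |
          ∃ x y, (x, y) ∈ MomentTorus.nullFibre (MomentTorus.torusLie K s) ∧
            O = MomentTorus.repOrbit (MomentTorus.doubleRep (MomentTorus.torusRep K s)) (x, y) ∧
            MomentTorus.IsSemisimpleElt (MomentTorus.torusRep K s) x ∧
            MomentTorus.IsSemisimpleElt (MomentTorus.torusRep K s).dual y}) ∧
    (¬ MomentTorus.IsVisible (MomentTorus.torusRep K s) →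
      ∀ c : Submodule K (Fin n → K),
        MomentTorus.IsCartanSubspace (MomentTorus.torusRep K s) (MomentTorus.torusLie K s) c →
        (∀ c' : Submodule K (Module.Dual K (Fin n → K)),
          ∃ z ∈ MomentTorus.nullFibre (MomentTorus.torusLie K s),
            MomentTorus.IsSemisimpleElt
              (MomentTorus.doubleRep (MomentTorus.torusRep K s)) z ∧
            ∀ x ∈ c, ∀ y ∈ c',
              z ∉ MomentTorus.zariskiClosure K (MomentTorus.repOrbit
                (MomentTorus.doubleRep (MomentTorus.torusRep K s)) (x, y))) ∧
        IsEmpty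
          (MomentTorus.symplecticReductionRing (MomentTorus.torusRep K s)
              (MomentTorus.torusLie K s) ≃ₐ[K]
            MomentTorus.weylInvariantRing (MomentTorus.torusRep K s) c)) := by
  refine ⟨MomentTorus.isVisible_iff_closed_orbits s, fun hvis c hc => ?_⟩
  rw [(MomentTorus.isDiagonal_torusRep s).isVisible_iff] at hvis
  obtain ⟨v, rfl, hd⟩ := hc
  obtain ⟨v', hv, hcv⟩ := MomentTorus.cartanOf_eq_of_weight_zero v
  rw [hcv] at hd ⊢
  exact ⟨fun c' => MomentTorus.exists_closed_orbit_not_mem_closure hv hd.le hvis c',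
    MomentTorus.isEmpty_symplecticReductionRing_equiv hv hd.le hvis⟩
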